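/- **Theorem.** Let $M$ be a connected smooth ($C^\infty$) manifold without boundary (not necessarily compact), and let $N_1,N_2$ be connected closed smooth manifolds; no relation between the dimensions is assumed. Give the space $C^\infty(N_i,M)$ of smooth maps the $C^\infty$ topology, and for $i=1,2$ let $\mathcal N_i$ be a path component of $C^\infty(N_i,M)$. Let $$\mathcal B=\{(f_1,f_2,\rho_1,\rho_2)\in \mathcal N_1\times\mathcal N_2\times N_1\times N_2 \;:\; f_1(\rho_1)=f_2(\rho_2)\}$$ with the subspace topology. Choose base points $x_1\in N_1$, $x_2\in N_2$, $y\in M$ and let $\mathcal N_i^\bullet=\{f\in\mathcal N_i: f(x_i)=y\}$. Let $[N_i,M]^\bullet$ be the set of pointed homotopy classes of continuous pointed maps $(N_i,x_i)\to(M,y)$, with the standard left action of $\pi_1(M)=\pi_1(M,y)$ (change of a pointed map by a free homotopy along which the base point runs through a given loop) and the right action of $\pi_1(N_i)=\pi_1(N_i,x_i)$ given by $f\gamma=f\circ\gamma(1_{N_i})$, where $\gamma(1_{N_i})\in[N_i,N_i]^\bullet$ is the result of the standard action of $\gamma$ on the class of the identity; the two actions commute. Then the natural map $\pi_0(\mathcal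 N_i^\bullet)\to[N_i,M]^\bullet$ is injective and its image is invariant under both actions, so that $\pi_0(\mathcal N_i^\bullet)$ carries commuting actions of $\pi_1(M)$ and $\pi_1(N_i)$. Moreover, the inclusion $\mathcal N_1^\bullet\times\mathcal N_2^\bullet\to\mathcal B$, $(f_1,f_2)\mapsto(f_1,f_2,x_1,x_2)$, induces a bijection $$(\pi_1(N_1)\times\pi_1(N_2))\backslash\bigl(\pi_0(\mathcal N_1^\bullet)\times\pi_0(\mathcal N_2^\bullet)\bigr)/\pi_1(M)\;\xrightarrow{\ \cong\ }\;\pi_0(\mathcal B),$$ where $\pi_1(N_1)\times\pi_1(N_2)$ acts componentwise from the right and $\pi_1(M)$ acts diagonally from the left; that is, $(a_1,a_2)$ and $(b_1,b_2)$ are identified if and only if there are $\beta\in\pi_1(M)$ and $\gamma_i\in\pi_1(N_i)$ with $b_i=\beta a_i\gamma_i$ for $i=1,2$. Here $\pi_0$ denotes the set of path components. -/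

import Mathlib

open scoped Manifold ContDiff Topology unitInterval

noncomputable section

namespace CoincidencePi0

/-! ### Pointed homotopy classes and the two actions of fundamental groups -/

section Pointed

variable {X Y : Type*} [TopologicalSpace X] [TopologicalSpace Y]

/-- Continuous maps `X → Y` sending the base point `x` to the base point `y`. -/
abbrev PointedMap (x : X) (y : Y) : Type _ := {f : C(X, Y) // f x = y}

/-- Pointed homotopy, i.e. homotopy relative to the base point. -/
def pointedHomotopy (x : X) (y : Y) : Setoid (PointedMap x y) where
  r f g := f.1.HomotopicRel g.1 {x}
  iseqv := ⟨fun f => .refl f.1, fun h => h.symm, fun h h' => h.trans h'⟩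

/-- The set of pointed homotopy classes of pointed maps `(X, x) → (Y, y)`. -/
def PointedClass (x : X) (y : Y) : Type _ := Quotient (pointedHomotopy x y)

/-- The pointed homotopy class of a pointed map. -/
def PointedClass.mk {x : X} {y : Y} (f : PointedMap x y) : PointedClass x y :=
  Quotient.mk (pointedHomotopy x y) f

/-- `f` and `g` are freely homotopic by a homotopy along which the base point `x` runs
through the loop `p`. -/
def HomotopicAlong (x : X) {y : Y} (p : Path y y) (f g : C(X, Y)) : Prop :=
  ∃ H : f.Homotopy g, ∀ t, H (t, x) = p t

/-- The base point `x` of `X` is nondegenerate: `{0} × X ∪ I × {x}` is a retract of `I × X`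
(equivalently, the pair `(X, {x})` has the homotopy extension property). -/
class WellPointed (x : X) : Prop where
  exists_retraction : ∃ r : C(I × X, I × X), (∀ z, r (0, z) = (0, z)) ∧
    (∀ t, r (t, x) = (t, x)) ∧ ∀ q, (r q).1 = 0 ∨ (r q).2 = x

theorem exists_extension [T1Space X] (x : X) [WellPointed x] (f : C(X, Y)) (p : C(I, Y))
    (h : p 0 = f x) :
    ∃ F : C(I × X, Y), (∀ z, F (0, z) = f z) ∧ ∀ t, F (t, x) = p t := by
  classical
  obtain ⟨r, h0, hx, hr⟩ := WellPointed.exists_retraction (x := x)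
  have hA : IsClosed {q : I × X | (r q).1 = 0} :=
    isClosed_singleton.preimage (continuous_fst.comp r.continuous)
  have hB : IsClosed {q : I × X | (r q).2 = x} :=
    isClosed_singleton.preimage (continuous_snd.comp r.continuous)
  have hc : Continuous fun q : I × X => if (r q).1 = 0 then f (r q).2 else p (r q).1 := by
    rw [← continuousOn_univ]
    have hU : (Set.univ : Set (I × X)) = {q | (r q).1 = 0} ∪ {q | (r q).2 = x} := by
      ext q; simpa using hr q
    rw [hU]
    refine ContinuousOn.union_of_isClosed ?_ ?_ hA hB
    · refine ContinuousOn.congr (f := fun q => f (r q).2) (by fun_prop) ?_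
      intro q hq
      have hq' : (r q).1 = 0 := hq
      simp [hq']
    · refine ContinuousOn.congr (f := fun q => p (r q).1) (by fun_prop) ?_
      intro q hq
      have hq' : (r q).2 = x := hq
      by_cases h1 : (r q).1 = 0
      · simp [h1, hq', h]
      · simp [h1]
  refine ⟨⟨_, hc⟩, fun z => ?_, fun t => ?_⟩
  · simp [h0]
  · by_cases ht : t = 0
    · simp [hx, ht, h]
    · simp [hx, ht]

variable {x : X} {y : Y}

theorem HomotopicAlong.of_rel {f g : PointedMap x y} (h : f.1.HomotopicRel g.1 {x}) :
    HomotopicAlong x (Path.refl y) f.1 g.1 := by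
  obtain ⟨H⟩ := h
  refine ⟨H.toHomotopy, fun t => ?_⟩
  have := H.eq_fst t (Set.mem_singleton x)
  simpa [f.2] using this

theorem HomotopicAlong.symm {p : Path y y} {f g : C(X, Y)} (h : HomotopicAlong x p f g) :
    HomotopicAlong x p.symm g f := by
  obtain ⟨H, hH⟩ := h
  exact ⟨H.symm, fun t => by simp [hH]⟩

theorem HomotopicAlong.trans {p q : Path y y} {f g k : C(X, Y)} (h : HomotopicAlong x p f g)
    (h' : HomotopicAlong x q g k) : HomotopicAlong x (p.trans q) f k := by
  obtain ⟨H, hH⟩ := h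
  obtain ⟨H', hH'⟩ := h'
  refine ⟨H.trans H', fun t => ?_⟩
  rw [ContinuousMap.Homotopy.trans_apply, Path.trans_apply]
  split_ifs <;> simp [hH, hH']

theorem HomotopicAlong.homotopicRel [T1Space X] [WellPointed x] {p : Path y y}
    {f g : C(X, Y)} (h : HomotopicAlong x p f g) (hp : p.Homotopic (Path.refl y)) :
    f.HomotopicRel g {x} := by
  obtain ⟨K, hK⟩ := h
  obtain ⟨D⟩ := hp
  let k : C(X, C(I, Y)) := (K.toContinuousMap.comp ContinuousMap.prodSwap).curry
  have hk : ∀ z t, k z t = K (t, z) := fun z t => rfl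
  have hD : ∀ s t, D.toHomotopy.curry s t = D (s, t) := fun s t => rfl
  obtain ⟨F, hF0, hFx⟩ := exists_extension x k (D.toHomotopy.curry) (by
    ext t; rw [hD, hk, hK]; simp)
  have hfx : f x = y := by simpa using hK 0
  have hgx : g x = y := by simpa using hK 1
  let f' : C(X, Y) := ⟨fun z => F (1, z) 0, by fun_prop⟩
  let g' : C(X, Y) := ⟨fun z => F (1, z) 1, by fun_prop⟩
  have h1 : f.HomotopicRel f' {x} := by
    refine ⟨⟨⟨⟨fun q => F q 0, by fun_prop⟩, fun z => ?_, fun z => ?_⟩, ?_⟩⟩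
    · simp [hF0, hk]
    · rfl
    · rintro t z rfl
      simp [hFx, hD, hfx]
  have h2 : f'.HomotopicRel g' {x} := by
    refine ⟨⟨⟨⟨fun q => F (1, q.2) q.1, by fun_prop⟩, fun z => ?_, fun z => ?_⟩, ?_⟩⟩
    · rfl
    · rfl
    · rintro t z rfl
      simp [f', hFx]
  have h3 : g.HomotopicRel g' {x} := by
    refine ⟨⟨⟨⟨fun q => F q 1, by fun_prop⟩, fun z => ?_, fun z => ?_⟩, ?_⟩⟩
    · simp [hF0, hk]
    · rfl
    · rintro t z rfl
      simp [hFx, hD, hgx]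
  exact (h1.trans h2).trans h3.symm

/-- `a` is carried to `b` by a free homotopy whose base point track represents `β`. -/
def Carries (β : FundamentalGroup Y y) (a b : PointedClass x y) : Prop :=
  ∃ (p : Path y y) (f g : PointedMap x y), Path.Homotopic.Quotient.mk p = β.toPath ∧
    PointedClass.mk f = a ∧ PointedClass.mk g = b ∧ HomotopicAlong x p f.1 g.1

theorem Carries.one (a : PointedClass x y) : Carries (1 : FundamentalGroup Y y) a a := by
  obtain ⟨f, rfl⟩ := Quotient.exists_rep a
  exact ⟨Path.refl y, f, f, rfl, rfl, rfl, .of_rel (.refl f.1)⟩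

theorem Carries.inv {β : FundamentalGroup Y y} {a b : PointedClass x y} (h : Carries β a b) :
    Carries β⁻¹ b a := by
  obtain ⟨p, f, g, rfl, rfl, rfl, h⟩ := h
  exact ⟨p.symm, g, f, rfl, rfl, rfl, h.symm⟩

theorem Carries.mul {β γ : FundamentalGroup Y y} {a b c : PointedClass x y}
    (h : Carries β a b) (h' : Carries γ b c) : Carries (γ * β) a c := by
  obtain ⟨p, f, g, hp, rfl, rfl, h⟩ := h
  obtain ⟨q, g', k, hq, hg, rfl, h'⟩ := h'
  have hgg : g.1.HomotopicRel g'.1 {x} := (Quotient.exact hg.symm : _)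
  refine ⟨(p.trans (Path.refl y)).trans q, f, k, ?_, rfl, rfl,
    (h.trans (.of_rel hgg)).trans h'⟩
  rw [Path.Homotopic.Quotient.mk_trans, Path.Homotopic.Quotient.mk_trans,
    Path.Homotopic.Quotient.mk_refl, Path.Homotopic.Quotient.trans_refl, hp, hq]
  rfl

theorem Carries.eq_of_one [T1Space X] [WellPointed x] {a b : PointedClass x y}
    (h : Carries (1 : FundamentalGroup Y y) a b) : a = b := by
  obtain ⟨p, f, g, hp, rfl, rfl, h⟩ := h
  exact Quotient.sound (h.homotopicRel (Path.Homotopic.Quotient.exact hp))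

theorem Carries.unique [T1Space X] [WellPointed x] {β : FundamentalGroup Y y}
    {a b c : PointedClass x y} (h : Carries β a b) (h' : Carries β a c) : b = c :=
  Carries.eq_of_one (by simpa using h.inv.mul h')

theorem Carries.exists [T1Space X] [WellPointed x] (β : FundamentalGroup Y y)
    (a : PointedClass x y) : ∃ b, Carries β a b := by
  obtain ⟨p, hp⟩ := Path.Homotopic.Quotient.mk_surjective β.toPath
  obtain ⟨f, rfl⟩ := Quotient.exists_rep a
  obtain ⟨F, hF0, hFx⟩ := exists_extension x f.1 p.toContinuousMap (by simp [f.2])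
  let g : PointedMap x y := ⟨⟨fun z => F (1, z), by fun_prop⟩, by simp [hFx]⟩
  exact ⟨.mk g, p, f, g, hp, rfl, rfl, ⟨F, hF0, fun z => rfl⟩, hFx⟩

/-- The standard action of `π₁(Y, y)` on `[(X, x), (Y, y)]`: `β • [f] = [g]` when `f` is freely
homotopic to `g` along a loop in the class `β`. In Mathlib's `FundamentalGroup` the product
`γ * β` is the class of `β` followed by `γ`, so this is a left action. -/
instance piOneAction [T1Space X] [WellPointed x] :
    MulAction (FundamentalGroup Y y) (PointedClass x y) where
  smul β a := (Carries.exists β a).choose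
  one_smul a := (Carries.exists (1 : FundamentalGroup Y y) a).choose_spec.unique (Carries.one a)
  mul_smul γ β a := (Carries.exists (γ * β) a).choose_spec.unique
    ((Carries.exists β a).choose_spec.mul (Carries.exists γ _).choose_spec)

theorem smul_eq_iff [T1Space X] [WellPointed x] {β : FundamentalGroup Y y}
    {a b : PointedClass x y} : β • a = b ↔ Carries β a b :=
  ⟨fun h => h ▸ (Carries.exists β a).choose_spec,
    fun h => (Carries.exists β a).choose_spec.unique h⟩

theorem homotopicRel_comp {Z : Type*} [TopologicalSpace Z] {z : Z} {f f' : PointedMap y z}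
    {k k' : PointedMap x y} (hf : f.1.HomotopicRel f'.1 {y}) (hk : k.1.HomotopicRel k'.1 {x}) :
    (f.1.comp k.1).HomotopicRel (f'.1.comp k'.1) {x} := by
  obtain ⟨F⟩ := hf
  obtain ⟨K⟩ := hk
  refine ⟨⟨F.toHomotopy.comp K.toHomotopy, ?_⟩⟩
  intro t x' hx'
  rw [Set.mem_singleton_iff.1 hx']
  have h1 : K (t, x) = y := (K.eq_fst t (Set.mem_singleton x)).trans k.2
  have h2 : F (t, y) = z := (F.eq_fst t (Set.mem_singleton y)).trans f.2
  change F (t, K (t, x)) = f.1 (k.1 x)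
  rw [h1, h2, k.2, f.2]

/-- Composition of pointed homotopy classes. -/
def PointedClass.comp {Z : Type*} [TopologicalSpace Z] {z : Z} (a : PointedClass y z)
    (b : PointedClass x y) : PointedClass x z :=
  Quotient.map₂ (sa := pointedHomotopy y z) (sb := pointedHomotopy x y)
    (sc := pointedHomotopy x z)
    (fun f k => ⟨f.1.comp k.1, by simp [k.2, f.2]⟩)
    (fun _ _ hf _ _ hk => homotopicRel_comp hf hk) a b

/-- The class of the identity map. -/
def PointedClass.id (x : X) : PointedClass x x := .mk ⟨.id X, rfl⟩

theorem PointedClass.comp_id (a : PointedClass x y) : a.comp (.id x) = a := by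
  obtain ⟨f, rfl⟩ := Quotient.exists_rep a
  rfl

theorem PointedClass.comp_assoc {Z W : Type*} [TopologicalSpace Z] [TopologicalSpace W] {z : Z}
    {w : W} (a : PointedClass z w) (b : PointedClass y z) (c : PointedClass x y) :
    (a.comp b).comp c = a.comp (b.comp c) := by
  obtain ⟨f, rfl⟩ := Quotient.exists_rep a
  obtain ⟨g, rfl⟩ := Quotient.exists_rep b
  obtain ⟨k, rfl⟩ := Quotient.exists_rep c
  rfl

theorem Carries.comp {Z : Type*} [TopologicalSpace Z] {z : Z} {β : FundamentalGroup Z z}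
    {a b : PointedClass y z} (h : Carries β a b) (c : PointedClass x y) :
    Carries β (a.comp c) (b.comp c) := by
  obtain ⟨p, f, g, hp, rfl, rfl, H, hH⟩ := h
  obtain ⟨k, rfl⟩ := Quotient.exists_rep c
  refine ⟨p, ⟨f.1.comp k.1, by simp [k.2, f.2]⟩, ⟨g.1.comp k.1, by simp [k.2, g.2]⟩, hp, rfl, rfl,
    H.compContinuousMap k.1, fun t => ?_⟩
  change H (t, k.1 x) = p t
  rw [k.2, hH]

theorem smul_comp {Z : Type*} [TopologicalSpace Z] {z : Z} [T1Space X] [WellPointed x]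
    [T1Space Y] [WellPointed y] (β : FundamentalGroup Z z) (a : PointedClass y z)
    (c : PointedClass x y) : (β • a).comp c = β • a.comp c :=
  (smul_eq_iff.2 ((smul_eq_iff.1 rfl : Carries β a (β • a)).comp c)).symm

/-- The right action of `π₁(X, x)` on `[(X, x), (Y, y)]`, as an action of the opposite group:
`f γ = f ∘ γ(1_X)`, where `γ(1_X) = γ • [id]` is the result of the standard action of `γ` on
the class of the identity. -/
instance piOneRightAction [T1Space X] [WellPointed x] :
    MulAction (FundamentalGroup X x)ᵐᵒᵖ (PointedClass x y) where
  smul γ a := a.comp (γ.unop • PointedClass.id x)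
  one_smul a := by
    change a.comp ((1 : FundamentalGroup X x) • PointedClass.id x) = a
    rw [one_smul, a.comp_id]
  mul_smul δ γ a := by
    change a.comp ((γ.unop * δ.unop) • PointedClass.id x) =
      (a.comp (γ.unop • PointedClass.id x)).comp (δ.unop • PointedClass.id x)
    rw [mul_smul, PointedClass.comp_assoc, smul_comp]
    congr 2
    obtain ⟨f, hf⟩ := Quotient.exists_rep (δ.unop • PointedClass.id x)
    rw [← hf]
    rfl

instance piOneActionsCommute [T1Space X] [WellPointed x] :
    SMulCommClass (FundamentalGroup Y y) (FundamentalGroup X x)ᵐᵒᵖ (PointedClass x y) where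
  smul_comm β γ a := (smul_comp β a (γ.unop • PointedClass.id x)).symm

end Pointed

/-- `(a₁, a₂)` and `(b₁, b₂)` are equivalent when `b_i = β a_i γ_i` for some `β ∈ π₁(M)` (the same
for both coordinates) and `γ_i ∈ π₁(N_i)`: the orbit relation of the diagonal left action of
`π₁(M)` and the right action of `π₁(N₁) × π₁(N₂)`. -/
def doubleOrbit {N₁ N₂ M : Type*} [TopologicalSpace N₁] [TopologicalSpace N₂]
    [TopologicalSpace M] [T1Space N₁] [T1Space N₂] (x₁ : N₁) (x₂ : N₂) (y : M)
    [WellPointed x₁] [WellPointed x₂] : Setoid (PointedClass x₁ y × PointedClass x₂ y) where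
  r a b := ∃ (β : FundamentalGroup M y) (γ₁ : FundamentalGroup N₁ x₁)
    (γ₂ : FundamentalGroup N₂ x₂),
    b.1 = MulOpposite.op γ₁ • β • a.1 ∧ b.2 = MulOpposite.op γ₂ • β • a.2
  iseqv := by
    refine ⟨fun a => ⟨1, 1, 1, ?_, ?_⟩, ?_, ?_⟩
    · rw [MulOpposite.op_one, one_smul, one_smul]
    · rw [MulOpposite.op_one, one_smul, one_smul]
    · rintro a b ⟨β, γ₁, γ₂, h₁, h₂⟩
      refine ⟨β⁻¹, γ₁⁻¹, γ₂⁻¹, ?_, ?_⟩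
      · rw [h₁, smul_comm β⁻¹, MulOpposite.op_inv, inv_smul_smul, inv_smul_smul]
      · rw [h₂, smul_comm β⁻¹, MulOpposite.op_inv, inv_smul_smul, inv_smul_smul]
    · rintro a b c ⟨β, γ₁, γ₂, h₁, h₂⟩ ⟨β', γ₁', γ₂', h₁', h₂'⟩
      refine ⟨β' * β, γ₁ * γ₁', γ₂ * γ₂', ?_, ?_⟩
      · rw [h₁', h₁, smul_comm β', MulOpposite.op_mul, mul_smul, mul_smul]
      · rw [h₂', h₂, smul_comm β', MulOpposite.op_mul, mul_smul, mul_smul]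

/-! ### Base points of manifolds are nondegenerate -/

section Retraction

variable {E : Type*} [NormedAddCommGroup E] [NormedSpace ℝ E]

/-- Move `v` towards `0` by the distance `a` (soft thresholding). -/
def shrink (a : ℝ) (v : E) : E := (max 0 (‖v‖ - a) / ‖v‖) • v

theorem norm_shrink {a : ℝ} {v : E} : ‖shrink a v‖ = max 0 (‖v‖ - a) ∨ v = 0 := by
  by_cases hv : v = 0
  · exact .inr hv
  · left
    have : ‖v‖ ≠ 0 := by simpa using hv
    rw [shrink, norm_smul, norm_div, norm_norm, div_mul_cancel₀ _ this, Real.norm_eq_abs,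
      abs_of_nonneg (le_max_left _ _)]

theorem norm_shrink_le {a : ℝ} (ha : 0 ≤ a) (v : E) : ‖shrink a v‖ ≤ ‖v‖ := by
  rcases norm_shrink (a := a) (v := v) with h | h
  · rw [h]; exact max_le (norm_nonneg _) (by linarith)
  · simp [shrink, h]

theorem shrink_zero (v : E) : shrink 0 v = v := by
  by_cases hv : v = 0
  · simp [shrink, hv]
  · have : ‖v‖ ≠ 0 := by simpa using hv
    simp [shrink, this]

theorem shrink_of_le {a : ℝ} {v : E} (h : ‖v‖ ≤ a) : shrink a v = 0 := by
  simp [shrink, h]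

theorem continuous_shrink {T : Type*} [TopologicalSpace T] {a : T → ℝ} {v : T → E}
    (ha : Continuous a) (ha0 : ∀ t, 0 ≤ a t) (hv : Continuous v) :
    Continuous fun t => shrink (a t) (v t) := by
  rw [continuous_iff_continuousAt]
  intro t
  by_cases ht : v t = 0
  · have h0 : shrink (a t) (v t) = 0 := by simp [shrink, ht]
    rw [ContinuousAt, h0]
    refine squeeze_zero_norm (fun s => norm_shrink_le (ha0 s) (v s)) ?_
    have := (hv.norm).tendsto t
    simpa [ht] using this
  · have ht' : ‖v t‖ ≠ 0 := by simpa using ht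
    unfold shrink
    exact (((continuousAt_const.max (hv.norm.continuousAt.sub ha.continuousAt))).div
      hv.norm.continuousAt ht').smul hv.continuousAt

end Retraction

/-- Every point of a Hausdorff topological manifold is a nondegenerate base point. -/
theorem wellPointed_of_chartedSpace (n : ℕ) {N : Type*} [TopologicalSpace N]
    [ChartedSpace (EuclideanSpace ℝ (Fin n)) N] [T2Space N] (x : N) : WellPointed x := by
  classical
  let e := chartAt (EuclideanSpace ℝ (Fin n)) x
  have hxs : x ∈ e.source := mem_chart_source _ x
  obtain ⟨R, hR, hball⟩ : ∃ R > 0, Metric.closedBall (e x) R ⊆ e.target :=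
    Metric.nhds_basis_closedBall.mem_iff.1 (e.open_target.mem_nhds (e.map_source hxs))
  let c := e x
  let D : Set N := e.symm '' Metric.closedBall c R
  let U : Set N := e.symm '' Metric.ball c R
  have hD : IsClosed D := ((isCompact_closedBall c R).image_of_continuousOn
    (e.continuousOn_symm.mono hball)).isClosed
  have hU : IsOpen U := e.symm.isOpen_image_of_subset_source Metric.isOpen_ball
    (Metric.ball_subset_closedBall.trans hball)
  have hDs : D ⊆ e.source := by
    rintro _ ⟨v, hv, rfl⟩
    exact e.map_target (hball hv)
  have hDn : ∀ z ∈ D, ‖e z - c‖ ≤ R := by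
    rintro _ ⟨v, hv, rfl⟩
    rw [e.right_inv (hball hv)]
    simpa [dist_eq_norm] using hv
  have hUn : ∀ z ∈ D, z ∉ U → ‖e z - c‖ = R := by
    intro z hz hzU
    refine le_antisymm (hDn z hz) (not_lt.1 fun hlt => hzU ⟨e z, ?_, e.left_inv (hDs hz)⟩)
    simpa [dist_eq_norm] using hlt
  -- the threshold and the two coordinates of the retraction, as functions of `t` and of the vector
  let a : I × EuclideanSpace ℝ (Fin n) → ℝ := fun q => q.1 * max 0 (R - ‖q.2‖)
  have ha : Continuous a := by fun_prop
  have ha0 : ∀ q, 0 ≤ a q := fun q => mul_nonneg q.1.2.1 (le_max_left _ _)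
  have haR : ∀ q, a q ≤ R := fun q => by
    have h1 : max 0 (R - ‖q.2‖) ≤ R := max_le hR.le (by linarith [norm_nonneg q.2])
    calc a q ≤ 1 * max 0 (R - ‖q.2‖) :=
          mul_le_mul_of_nonneg_right q.1.2.2 (le_max_left _ _)
      _ ≤ R := by rw [one_mul]; exact h1
  let τ : I × EuclideanSpace ℝ (Fin n) → I := fun q =>
    ⟨max 0 (a q - ‖q.2‖) / R, div_nonneg (le_max_left _ _) hR.le, by
      rw [div_le_one hR]
      exact max_le hR.le (by linarith [haR q, norm_nonneg q.2])⟩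
  have hτ : Continuous τ := by
    refine Continuous.subtype_mk ?_ _
    fun_prop
  let w : I × EuclideanSpace ℝ (Fin n) → EuclideanSpace ℝ (Fin n) := fun q => shrink (a q) q.2
  have hw : Continuous w := continuous_shrink ha ha0 continuous_snd
  let r : I × N → I × N := fun q =>
    if q.2 ∈ D then (τ (q.1, e q.2 - c), e.symm (c + w (q.1, e q.2 - c))) else (0, q.2)
  -- on the part of the boundary that is shared, both branches agree
  have hbd : ∀ q : I × N, q.2 ∈ D → q.2 ∉ U → r q = (0, q.2) := by
    intro q hq hqU
    have hn := hUn q.2 hq hqU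
    have ha' : a (q.1, e q.2 - c) = 0 := by simp [a, hn]
    have h1 : τ (q.1, e q.2 - c) = 0 := by
      apply Subtype.ext
      simp [τ, ha']
    have h2 : w (q.1, e q.2 - c) = e q.2 - c := by simp [w, ha', shrink_zero]
    simp [r, hq, h1, h2, e.left_inv (hDs hq)]
  have hcont : Continuous r := by
    rw [← continuousOn_univ]
    have huniv : (Set.univ : Set (I × N)) = Prod.snd ⁻¹' D ∪ Prod.snd ⁻¹' Uᶜ := by
      ext q
      by_cases hq : q.2 ∈ U
      · simp only [Set.mem_univ, Set.mem_union, true_iff]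
        exact .inl (Set.image_mono Metric.ball_subset_closedBall hq)
      · simp [hq]
    rw [huniv]
    refine ContinuousOn.union_of_isClosed ?_ ?_ (hD.preimage continuous_snd)
      (hU.isClosed_compl.preimage continuous_snd)
    · have he : ContinuousOn (fun q : I × N => (q.1, e q.2 - c)) (Prod.snd ⁻¹' D) :=
        continuousOn_fst.prodMk (((e.continuousOn.mono hDs).comp continuousOn_snd
          (fun q hq => hq)).sub continuousOn_const)
      have h2 : ContinuousOn (fun q : I × N => e.symm (c + w (q.1, e q.2 - c)))
          (Prod.snd ⁻¹' D) := by
        refine (e.continuousOn_symm.mono hball).comp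
          (continuousOn_const.add (hw.comp_continuousOn he)) ?_
        intro q hq
        rw [Metric.mem_closedBall, dist_eq_norm]
        have := norm_shrink_le (ha0 (q.1, e q.2 - c)) (e q.2 - c)
        have h3 := hDn q.2 hq
        have h4 : c + w (q.1, e q.2 - c) - e x = w (q.1, e q.2 - c) := add_sub_cancel_left _ _
        rw [h4]
        exact this.trans h3
      refine ((hτ.comp_continuousOn he).prodMk h2).congr ?_
      intro q hq
      have hq' : q.2 ∈ D := hq
      simp [r, hq']
    · refine ContinuousOn.congr (f := fun q : I × N => ((0 : I), q.2)) (by fun_prop) ?_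
      intro q hq
      by_cases hqD : q.2 ∈ D
      · exact hbd q hqD hq
      · simp [r, hqD]
  have hxD : x ∈ D := ⟨c, Metric.mem_closedBall_self hR.le, e.left_inv hxs⟩
  refine ⟨⟨r, hcont⟩, fun z => ?_, fun t => ?_, fun q => ?_⟩
  · by_cases hz : z ∈ D
    · have ha' : a (0, e z - c) = 0 := by simp [a]
      have h1 : τ (0, e z - c) = 0 := by
        apply Subtype.ext
        simp [τ, ha']
      have h2 : w (0, e z - c) = e z - c := by simp [w, ha', shrink_zero]
      simp [r, hz, h1, h2, e.left_inv (hDs hz)]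
    · simp [r, hz]
  · have h0 : e x - c = 0 := sub_self _
    have ha' : a (t, 0) = t * R := by simp [a, hR.le]
    have h1 : τ (t, 0) = t := by
      apply Subtype.ext
      have : 0 ≤ (t : ℝ) * R := mul_nonneg t.2.1 hR.le
      simp only [τ, ha', norm_zero, sub_zero, max_eq_right this]
      exact mul_div_cancel_right₀ _ hR.ne'
    have h2 : w (t, 0) = 0 := by simp [w, shrink]
    simp [r, hxD, h1, h2, c, e.left_inv hxs]
  · by_cases hq : q.2 ∈ D
    · by_cases hle : ‖e q.2 - c‖ ≤ a (q.1, e q.2 - c)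
      · right
        have h2 : w (q.1, e q.2 - c) = 0 := shrink_of_le hle
        simp [r, hq, h2, c, e.left_inv hxs]
      · left
        have : max 0 (a (q.1, e q.2 - c) - ‖e q.2 - c‖) = 0 :=
          max_eq_left (by linarith [not_le.1 hle])
        have h1 : τ (q.1, e q.2 - c) = 0 := by
          apply Subtype.ext
          simp [τ, this]
        simp [r, hq, h1]
    · left
      simp [r, hq]

/-! ### The space of smooth maps and the space `B` -/

section Smooth

variable {n m : ℕ} {N M : Type*}
  [TopologicalSpace N] [ChartedSpace (EuclideanSpace ℝ (Fin n)) N]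
  [TopologicalSpace M] [ChartedSpace (EuclideanSpace ℝ (Fin m)) M]

/-- The set of smooth maps `g` that send `K` into the domain of the chart `ψ` and whose
expression in the charts `φ`, `ψ`, together with its derivatives of order at most `k`,
is `ε`-close to that of `f` on `K`. -/
def chartNhd (f : C^∞⟮𝓡 n, N; 𝓡 m, M⟯)
    (φ : OpenPartialHomeomorph N (EuclideanSpace ℝ (Fin n)))
    (ψ : OpenPartialHomeomorph M (EuclideanSpace ℝ (Fin m)))
    (K : Set N) (k : ℕ) (ε : ℝ) : Set C^∞⟮𝓡 n, N; 𝓡 m, M⟯ :=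
  {g | Set.MapsTo g K ψ.source ∧ ∀ j ≤ k, ∀ x ∈ K,
    ‖iteratedFDeriv ℝ j (ψ ∘ g ∘ φ.symm) (φ x) - iteratedFDeriv ℝ j (ψ ∘ f ∘ φ.symm) (φ x)‖ < ε}

/-- The `C^∞` topology on the space of smooth maps `N → M` (uniform convergence of all derivatives
in charts on compact sets), generated by the sets `chartNhd f φ ψ K k ε` where `φ`, `ψ` are smooth
charts, `K` is a compact subset of the domain of `φ`, `f` maps `K` into the domain of `ψ`, and
`ε > 0`. -/
instance smoothMapTopology : TopologicalSpace C^∞⟮𝓡 n, N; 𝓡 m, M⟯ :=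
  TopologicalSpace.generateFrom
    {S | ∃ (f : C^∞⟮𝓡 n, N; 𝓡 m, M⟯)
      (φ : OpenPartialHomeomorph N (EuclideanSpace ℝ (Fin n)))
      (ψ : OpenPartialHomeomorph M (EuclideanSpace ℝ (Fin m)))
      (K : Set N) (k : ℕ) (ε : ℝ),
      φ ∈ IsManifold.maximalAtlas (𝓡 n) ∞ N ∧ ψ ∈ IsManifold.maximalAtlas (𝓡 m) ∞ M ∧
      IsCompact K ∧ K ⊆ φ.source ∧ Set.MapsTo f K ψ.source ∧ 0 < ε ∧
      S = chartNhd f φ ψ K k ε}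

/-- A smooth map as a continuous map. -/
def toContinuousMap (f : C^∞⟮𝓡 n, N; 𝓡 m, M⟯) : C(N, M) := ⟨f, f.contMDiff.continuous⟩

theorem continuous_toContinuousMap [IsManifold (𝓡 n) ∞ N] [IsManifold (𝓡 m) ∞ M] :
    Continuous (toContinuousMap : C^∞⟮𝓡 n, N; 𝓡 m, M⟯ → C(N, M)) := by
  have : LocallyCompactSpace N :=
    ChartedSpace.locallyCompactSpace (EuclideanSpace ℝ (Fin n)) N
  refine ContinuousMap.continuous_compactOpen.2 fun K hK U hU => ?_
  rw [isOpen_iff_mem_nhds]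
  intro f hf
  -- near every point of `K` the condition holds on a neighbourhood, for all `g` close to `f`
  have key : ∀ x ∈ K, ∃ L ∈ 𝓝 x, ∀ᶠ g : C^∞⟮𝓡 n, N; 𝓡 m, M⟯ in 𝓝 f, Set.MapsTo g L U := by
    intro x hx
    let φ := chartAt (EuclideanSpace ℝ (Fin n)) x
    let ψ := chartAt (EuclideanSpace ℝ (Fin m)) (f x)
    have hV : IsOpen (U ∩ ψ.source) := hU.inter ψ.open_source
    have hfx : f x ∈ U ∩ ψ.source := ⟨hf hx, mem_chart_source _ _⟩
    have hO : φ.source ∩ f ⁻¹' (U ∩ ψ.source) ∈ 𝓝 x :=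
      Filter.inter_mem (φ.open_source.mem_nhds (mem_chart_source _ _))
        (f.contMDiff.continuous.continuousAt (hV.mem_nhds hfx))
    obtain ⟨L, hL, hLs, hLc⟩ := local_compact_nhds hO
    have hLψ : Set.MapsTo f L ψ.source := fun z hz => (hLs hz).2.2
    have himg : IsCompact ((fun z => ψ (f z)) '' L) :=
      hLc.image_of_continuousOn
        (ψ.continuousOn.comp f.contMDiff.continuous.continuousOn hLψ)
    have hopen : IsOpen (ψ '' (U ∩ ψ.source)) :=
      ψ.isOpen_image_of_subset_source hV Set.inter_subset_right
    obtain ⟨ε, hε, hth⟩ := himg.exists_thickening_subset_open hopen (by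
      rintro _ ⟨z, hz, rfl⟩
      exact ⟨f z, (hLs hz).2, rfl⟩)
    refine ⟨L, hL, ?_⟩
    have hmem : chartNhd f φ ψ L 0 ε ∈ 𝓝 f := by
      have ho : IsOpen (chartNhd f φ ψ L 0 ε) := TopologicalSpace.isOpen_generateFrom_of_mem
        ⟨f, φ, ψ, L, 0, ε, IsManifold.chart_mem_maximalAtlas x,
          IsManifold.chart_mem_maximalAtlas (f x), hLc, fun z hz => (hLs hz).1, hLψ, hε, rfl⟩
      exact ho.mem_nhds ⟨hLψ, fun j _ z _ => by simpa using hε⟩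
    filter_upwards [hmem] with g hg z hz
    have hgz : g z ∈ ψ.source := hg.1 hz
    have hzφ : z ∈ φ.source := (hLs hz).1
    have hd : ‖ψ (g z) - ψ (f z)‖ < ε := by
      have := hg.2 0 le_rfl z hz
      have hsub : iteratedFDeriv ℝ 0 (ψ ∘ g ∘ φ.symm) (φ z) -
          iteratedFDeriv ℝ 0 (ψ ∘ f ∘ φ.symm) (φ z) =
          iteratedFDeriv ℝ 0 (fun v => (ψ ∘ g ∘ φ.symm) v - (ψ ∘ f ∘ φ.symm) v) (φ z) := by
        ext v
        simp
      rw [hsub, norm_iteratedFDeriv_zero] at this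
      simpa [φ.left_inv hzφ] using this
    have hin : ψ (g z) ∈ Metric.thickening ε ((fun z => ψ (f z)) '' L) :=
      Metric.mem_thickening_iff.2 ⟨ψ (f z), ⟨z, hz, rfl⟩, by simpa [dist_eq_norm] using hd⟩
    obtain ⟨u, hu, hu'⟩ := hth hin
    have : u = g z := ψ.injOn hu.2 hgz hu'
    exact this ▸ hu.1
  choose! L hL hLU using key
  obtain ⟨T, hTK, hT⟩ := hK.elim_nhds_subcover L hL
  have hfin : ∀ᶠ g : C^∞⟮𝓡 n, N; 𝓡 m, M⟯ in 𝓝 f, ∀ x ∈ T, Set.MapsTo g (L x) U :=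
    (Filter.eventually_all_finset T).2 fun x hx => hLU x (hTK x hx)
  filter_upwards [hfin] with g hg z hz
  obtain ⟨x, hx, hzx⟩ := Set.mem_iUnion₂.1 (hT hz)
  exact hg x hx hzx

/-- The space of smooth maps in the path component of `φ` that send `x` to `y`. -/
abbrev PointedComponent (φ : C^∞⟮𝓡 n, N; 𝓡 m, M⟯) (x : N) (y : M) : Type _ :=
  {f : C^∞⟮𝓡 n, N; 𝓡 m, M⟯ // f ∈ pathComponent φ ∧ f x = y}

/-- The map sending a path component of the space of pointed smooth maps to the
pointed homotopy class of its members. -/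
def toPointedClass [IsManifold (𝓡 n) ∞ N] [IsManifold (𝓡 m) ∞ M]
    (φ : C^∞⟮𝓡 n, N; 𝓡 m, M⟯) (x : N) (y : M) :
    ZerothHomotopy (PointedComponent φ x y) → PointedClass x y :=
  Quotient.lift (fun f => PointedClass.mk ⟨toContinuousMap f.1, f.2.2⟩) (by
    rintro f g ⟨p⟩
    have : LocallyCompactSpace N :=
      ChartedSpace.locallyCompactSpace (EuclideanSpace ℝ (Fin n)) N
    have hc : Continuous fun t : I => toContinuousMap (p t).1 :=
      continuous_toContinuousMap.comp (continuous_subtype_val.comp p.continuous)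
    refine Quotient.sound ⟨⟨⟨⟨fun q => toContinuousMap (p q.1).1 q.2, ?_⟩, fun z => ?_,
      fun z => ?_⟩, ?_⟩⟩
    · exact ContinuousMap.continuous_uncurry_of_continuous ⟨_, hc⟩
    · simp
    · simp
    · rintro t _ rfl
      exact (p t).2.2.trans f.2.2.symm)

end Smooth

section Coincidence

variable {n₁ n₂ m : ℕ} {N₁ N₂ M : Type*}
  [TopologicalSpace N₁] [ChartedSpace (EuclideanSpace ℝ (Fin n₁)) N₁]
  [TopologicalSpace N₂] [ChartedSpace (EuclideanSpace ℝ (Fin n₂)) N₂]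
  [TopologicalSpace M] [ChartedSpace (EuclideanSpace ℝ (Fin m)) M]

/-- The space `B` of quadruples `(f₁, f₂, ρ₁, ρ₂)` with `f_i` in the path component of `φ_i`,
`ρ_i ∈ N_i` (a map from the one-point space to `N_i`) and `f₁ ρ₁ = f₂ ρ₂`, with the subspace
topology. -/
abbrev CoincidenceSpace (φ₁ : C^∞⟮𝓡 n₁, N₁; 𝓡 m, M⟯) (φ₂ : C^∞⟮𝓡 n₂, N₂; 𝓡 m, M⟯) : Type _ :=
  {q : C^∞⟮𝓡 n₁, N₁; 𝓡 m, M⟯ × C^∞⟮𝓡 n₂, N₂; 𝓡 m, M⟯ × N₁ × N₂ //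
    q.1 ∈ pathComponent φ₁ ∧ q.2.1 ∈ pathComponent φ₂ ∧ q.1 q.2.2.1 = q.2.1 q.2.2.2}

/-- The inclusion of pairs of pointed maps into `B`, with `ρ₁ = x₁` and `ρ₂ = x₂`. -/
def pointedInclusion (φ₁ : C^∞⟮𝓡 n₁, N₁; 𝓡 m, M⟯) (φ₂ : C^∞⟮𝓡 n₂, N₂; 𝓡 m, M⟯)
    (x₁ : N₁) (x₂ : N₂) (y : M) (f₁ : PointedComponent φ₁ x₁ y) (f₂ : PointedComponent φ₂ x₂ y) :
    CoincidenceSpace φ₁ φ₂ :=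
  ⟨(f₁.1, f₂.1, x₁, x₂), f₁.2.1, f₂.2.1, f₁.2.2.trans f₂.2.2.symm⟩

/-- The double quotient `(π₁(N₁) × π₁(N₂)) \ (π₀(𝒩₁•) × π₀(𝒩₂•)) / π₁(M)`, where `π₀(𝒩_i•)` is
regarded as a set of pointed homotopy classes of maps `N_i → M`. -/
def doubleQuotientSetoid [IsManifold (𝓡 n₁) ∞ N₁] [IsManifold (𝓡 n₂) ∞ N₂]
    [IsManifold (𝓡 m) ∞ M] [T2Space N₁] [T2Space N₂]
    (φ₁ : C^∞⟮𝓡 n₁, N₁; 𝓡 m, M⟯) (φ₂ : C^∞⟮𝓡 n₂, N₂; 𝓡 m, M⟯) (x₁ : N₁) (x₂ : N₂) (y : M) :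
    Setoid (ZerothHomotopy (PointedComponent φ₁ x₁ y) ×
      ZerothHomotopy (PointedComponent φ₂ x₂ y)) :=
  haveI := wellPointed_of_chartedSpace n₁ x₁
  haveI := wellPointed_of_chartedSpace n₂ x₂
  (doubleOrbit x₁ x₂ y).comap (Prod.map (toPointedClass φ₁ x₁ y) (toPointedClass φ₂ x₂ y))

/-- A set of pointed homotopy classes of maps from an `n`-manifold `N` is invariant under the
actions of `π₁(M)` and `π₁(N)`. -/
def IsInvariant (n : ℕ) {N M : Type*} [TopologicalSpace N]
    [ChartedSpace (EuclideanSpace ℝ (Fin n)) N] [T2Space N] [TopologicalSpace M]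
    (x : N) (y : M) (S : Set (PointedClass x y)) : Prop :=
  haveI := wellPointed_of_chartedSpace n x
  (∀ (β : FundamentalGroup M y), ∀ a ∈ S, β • a ∈ S) ∧
    ∀ (γ : FundamentalGroup N x), ∀ a ∈ S, MulOpposite.op γ • a ∈ S

end Coincidence

end CoincidencePi0

end

/-!
The proof rests on two facts about the space of smooth maps `N → M` in the `C^∞` topology.

* `exists_lift_eval`: paths lift along the evaluation `f ↦ f ρ`. Locally, `f` is translated in a
  chart of `M` with a cutoff near `ρ`.
* `exists_path_of_homotopicRel`: smooth maps that are homotopic relative to the base point are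
  joined by a path of smooth maps with a constant value at the base point. The homotopy, regarded as
  a map on `ℝ × N`, is first made smooth near the base point and then smoothed chart by chart
  (`exists_contMDiff_eqOn`); no embedding of `M` or tubular neighbourhood is needed.

In both, the passage from jointly smooth families to continuous paths in the `C^∞` topology is
`continuousAt_smoothFamily`.

The second fact gives the injectivity of `π₀(𝒩•) → [N, M]•`. By the first, the class `β [f]` is
represented by the end point of a lift of a loop in the class `β`, which stays in the path component
of `f`. Moreover `[f] γ = (f_* γ) [f]` (`op_smul_toPointedClass`), so the image is invariant under
both actions.

For the bijection: every point `(f₁, f₂, ρ₁, ρ₂)` of `B` can be joined to a pair of pointed maps by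
moving `ρ₁`, then `ρ₂`, then the common value, with the maps following by path lifting. If
`b_i = β a_i γ_i`, then pairs of pointed maps in these classes are joined in `B`, since each of the
three multiplications is realized by such motions, after which the second fact applies. Conversely,
let a path in `B` join two pairs of pointed maps, let `γ_i` be the loops of its points in the `N_i`,
and let `β` be the loop of their common value. Composing the maps with a homotopy of the identity of
`N_i` along `γ_i` yields a homotopy along `β` from the first map to the composite of the second with
`γ_i(1)`, that is, `b_i γ_i = β a_i` (`op_smul_eq_smul_of_track`).
-/

open scoped Manifold ContDiff Topology unitInterval

noncomputable section

namespace CoincidencePi0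

/-! ### Continuity of smooth families in the smooth topology -/

section Continuity

variable {E E' F : Type*} [NormedAddCommGroup E] [NormedSpace ℝ E] [NormedAddCommGroup E']
  [NormedSpace ℝ E'] [NormedAddCommGroup F] [NormedSpace ℝ F]

/-- The partial derivatives of order `j` in the second variable of a function of two variables
have, jointly in both variables, the order of differentiability of the function reduced by `j`. -/
theorem contDiffAt_iteratedFDeriv_snd {g : E' × E → F} {p : E' × E} {j m : ℕ}
    (hg : ContDiffAt ℝ ((m + j : ℕ) : WithTop ℕ∞) g p) :
    ContDiffAt ℝ m (fun q : E' × E => iteratedFDeriv ℝ j (fun v => g (q.1, v)) q.2) p := by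
  induction j generalizing m with
  | zero =>
    simp only [iteratedFDeriv_zero_eq_comp, Function.comp_def, Prod.mk.eta]
    exact (continuousMultilinearCurryFin0 ℝ E F).symm.contDiff.contDiffAt.comp p
      (by simpa using hg)
  | succ j ih =>
    simp only [iteratedFDeriv_succ_eq_comp_left, Function.comp_def]
    have h := ih (m := m + 1) (by convert hg using 2; omega)
    have h2 : ContDiffAt ℝ ((m + 1 : ℕ) : WithTop ℕ∞)
        (fun r : (E' × E) × E => (r.1.1, r.2)) (p, p.2) := by fun_prop
    have h3 := ContDiffAt.comp (f := fun r : (E' × E) × E => (r.1.1, r.2)) (p, p.2) h h2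
    have h4 : ContDiffAt ℝ m (fun q : E' × E => fderiv ℝ
        (fun v => iteratedFDeriv ℝ j (fun v => g (q.1, v)) v) q.2) p :=
      ContDiffAt.fderiv (n := ((m + 1 : ℕ) : WithTop ℕ∞)) h3 contDiffAt_snd (by norm_cast)
    exact h4.continuousLinearMap_comp
      ((continuousMultilinearCurryLeftEquiv ℝ (fun _ : Fin (j + 1) => E) F).symm :
        _ →L[ℝ] E [×(j + 1)]→L[ℝ] F)

variable {n m : ℕ} {N M : Type*}
  [TopologicalSpace N] [ChartedSpace (EuclideanSpace ℝ (Fin n)) N]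
  [TopologicalSpace M] [ChartedSpace (EuclideanSpace ℝ (Fin m)) M]

/-- A family of smooth maps that is obtained from a jointly smooth family by a continuous
change of the parameter depends continuously on the parameter in the `C^∞` topology. Only the
map `u` into the normed space `E'` is required to be continuous in `a`, so that continuous paths
of smooth maps arise from smooth families without any smoothness in time. -/
theorem continuousAt_smoothFamily [IsManifold (𝓡 n) ∞ N] [IsManifold (𝓡 m) ∞ M]
    {X : Type*} [TopologicalSpace X]
    {F : X → C^∞⟮𝓡 n, N; 𝓡 m, M⟯} {u : X → E'} {G : E' × N → M} {a : X}
    (hu : ContinuousAt u a) (hF : ∀ x z, F x z = G (u x, z))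
    (hG : ∀ z, ContMDiffAt (𝓘(ℝ, E').prod (𝓡 n)) (𝓡 m) ∞ G (u a, z)) : ContinuousAt F a := by
  rw [ContinuousAt, TopologicalSpace.tendsto_nhds_generateFrom_iff]
  rintro _ ⟨f, φ, ψ, K, k, ε, hφ, hψ, hK, hKφ, hfK, hε, rfl⟩ hFa
  refine hK.eventually_forall_of_forall_eventually (P := fun x z => F x z ∈ ψ.source ∧
    ∀ j ≤ k, ‖iteratedFDeriv ℝ j (ψ ∘ F x ∘ φ.symm) (φ z) -
      iteratedFDeriv ℝ j (ψ ∘ f ∘ φ.symm) (φ z)‖ < ε) (x₀ := a) ?_ |>.mono fun x hx =>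
        ⟨fun z hz => (hx z hz).1, fun j hj z hz => (hx z hz).2 j hj⟩
  intro z hz
  have hzφ := hKφ hz
  have huz : ContinuousAt (fun q : X × N => (u q.1, q.2)) (a, z) :=
    (hu.comp continuousAt_fst).prodMk continuousAt_snd
  refine Filter.Eventually.and ?_ ?_
  · have h1 : ContinuousAt (fun q : X × N => F q.1 q.2) (a, z) := by
      simp only [hF]
      exact (hG z).continuousAt.comp (f := fun q : X × N => (u q.1, q.2)) huz
    exact h1.eventually_mem (ψ.open_source.mem_nhds (hFa.1 hz))
  · have hφs : ContMDiffAt (𝓡 n) (𝓡 n) ∞ φ.symm (φ z) :=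
      contMDiffAt_symm_of_mem_maximalAtlas hφ (φ.map_source hzφ)
    -- the family read in the charts
    let g : E' × EuclideanSpace ℝ (Fin n) → EuclideanSpace ℝ (Fin m) :=
      fun q => ψ (G (q.1, φ.symm q.2))
    have hg : ContDiffAt ℝ ∞ g (u a, φ z) := by
      have h1 : ContMDiffAt 𝓘(ℝ, E' × EuclideanSpace ℝ (Fin n)) (𝓘(ℝ, E').prod (𝓡 n)) ∞
          (fun q : E' × EuclideanSpace ℝ (Fin n) => (q.1, φ.symm q.2)) (u a, φ z) :=
        contDiffAt_fst.contMDiffAt.prodMk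
          (ContMDiffAt.comp (u a, φ z) hφs contDiffAt_snd.contMDiffAt)
      have h2 : ContMDiffAt (𝓡 m) (𝓡 m) ∞ ψ (G (u a, z)) :=
        contMDiffAt_of_mem_maximalAtlas hψ (hF a z ▸ hFa.1 hz)
      have h3 : ContMDiffAt 𝓘(ℝ, E' × EuclideanSpace ℝ (Fin n)) (𝓡 m) ∞
          (fun q : E' × EuclideanSpace ℝ (Fin n) => G (q.1, φ.symm q.2)) (u a, φ z) :=
        ContMDiffAt.comp_of_eq (hG z) h1 (by simp [φ.left_inv hzφ])
      exact (ContMDiffAt.comp_of_eq h2 h3 (by simp [φ.left_inv hzφ])).contDiffAt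
    have hf : ContDiffAt ℝ ∞ (ψ ∘ f ∘ φ.symm) (φ z) := by
      have h2 : ContMDiffAt (𝓡 m) (𝓡 m) ∞ ψ (f z) :=
        contMDiffAt_of_mem_maximalAtlas hψ (hfK hz)
      have h3 : ContMDiffAt (𝓡 n) (𝓡 m) ∞ (f ∘ φ.symm) (φ z) :=
        ContMDiffAt.comp (φ z) f.contMDiff.contMDiffAt hφs
      exact (ContMDiffAt.comp_of_eq h2 h3 (by simp [φ.left_inv hzφ])).contDiffAt
    have hφc : ContinuousAt (fun q : X × N => φ q.2) (a, z) :=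
      (φ.continuousAt hzφ).comp continuousAt_snd
    -- both derivatives are jointly continuous, so the strict inequality persists nearby
    have key : ∀ j ≤ k, ∀ᶠ q : X × N in 𝓝 (a, z),
        ‖iteratedFDeriv ℝ j (ψ ∘ F q.1 ∘ φ.symm) (φ q.2) -
          iteratedFDeriv ℝ j (ψ ∘ f ∘ φ.symm) (φ q.2)‖ < ε := by
      intro j hj
      have hA : ContinuousAt (fun q : X × N => iteratedFDeriv ℝ j (ψ ∘ F q.1 ∘ φ.symm) (φ q.2))
          (a, z) := by
        have h1 := (contDiffAt_iteratedFDeriv_snd (m := 0) (j := j)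
          (hg.of_le (by exact_mod_cast le_top))).continuousAt
        have h2 : ContinuousAt (fun q : X × N => (u q.1, φ q.2)) (a, z) :=
          (hu.comp continuousAt_fst).prodMk hφc
        have h3 := ContinuousAt.comp_of_eq (f := fun q : X × N => (u q.1, φ q.2)) h1 h2 rfl
        refine h3.congr (Filter.Eventually.of_forall fun q => ?_)
        have : (ψ ∘ F q.1 ∘ φ.symm) = fun v => g (u q.1, v) := by
          ext1 v
          simp [g, hF]
        simp only [Function.comp, this]
      have hB : ContinuousAt (fun q : X × N => iteratedFDeriv ℝ j (ψ ∘ f ∘ φ.symm) (φ q.2))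
          (a, z) := by
        have h1 := (hf.iteratedFDeriv_right (m := 0) (i := j) (by
          rw [zero_add]; exact_mod_cast le_top)).continuousAt
        exact ContinuousAt.comp_of_eq h1 hφc rfl
      exact (hA.sub hB).norm.eventually_lt continuousAt_const (hFa.2 j hj z hz)
    exact (Filter.eventually_all_finite (Set.finite_Iic k)).2 key

end Continuity

/-! ### Moving maps inside a chart -/

section ChartMove

variable {m : ℕ} {P M : Type*} [TopologicalSpace M]

/-- The convex combination, in the chart `ψ`, of the map `h` and the vector valued map `s`,
with weight `lam` on `s`. -/
def chartMix (ψ : OpenPartialHomeomorph M (EuclideanSpace ℝ (Fin m))) (lam : P → ℝ)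
    (s : P → EuclideanSpace ℝ (Fin m)) (h : P → M) (p : P) : EuclideanSpace ℝ (Fin m) :=
  ψ (h p) + lam p • (s p - ψ (h p))

variable {ψ : OpenPartialHomeomorph M (EuclideanSpace ℝ (Fin m))} {lam : P → ℝ}
  {s : P → EuclideanSpace ℝ (Fin m)} {h : P → M} {p : P}

theorem chartMix_of_eq_one (hp : lam p = 1) : chartMix ψ lam s h p = s p := by
  simp [chartMix, hp]

theorem chartMix_of_eq (hp : s p = ψ (h p)) : chartMix ψ lam s h p = ψ (h p) := by
  simp [chartMix, hp]

variable [TopologicalSpace P]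

open Classical in
/-- The map `h`, moved towards `s` in the chart `ψ` by the weight `lam`; outside the topological
support of `lam` it is `h`. It is continuous where `h` is, and smooth where `chartMix` or, outside
the support, `h` is, as long as on the support `h` takes values in the chart domain and `chartMix`
in the image of the chart. -/
def chartMove (ψ : OpenPartialHomeomorph M (EuclideanSpace ℝ (Fin m))) (lam : P → ℝ)
    (s : P → EuclideanSpace ℝ (Fin m)) (h : P → M) (p : P) : M :=
  if p ∈ tsupport lam then ψ.symm (chartMix ψ lam s h p) else h p

theorem chartMove_of_mem (hp : p ∈ tsupport lam) :
    chartMove ψ lam s h p = ψ.symm (chartMix ψ lam s h p) := if_pos hp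

theorem chartMove_of_notMem (hp : p ∉ tsupport lam) : chartMove ψ lam s h p = h p := if_neg hp

theorem chartMove_of_eq (hs : p ∈ tsupport lam → h p ∈ ψ.source) (hp : s p = ψ (h p)) :
    chartMove ψ lam s h p = h p := by
  by_cases hm : p ∈ tsupport lam
  · rw [chartMove_of_mem hm, chartMix_of_eq hp, ψ.left_inv (hs hm)]
  · exact chartMove_of_notMem hm

theorem chartMove_eventuallyEq_of_notMem (hp : p ∉ tsupport lam) :
    chartMove ψ lam s h =ᶠ[𝓝 p] h := by
  filter_upwards [(isClosed_tsupport lam).isOpen_compl.mem_nhds hp] with q hq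
  exact chartMove_of_notMem hq

theorem chartMove_eventuallyEq (hh : ContinuousAt h p) (hs : h p ∈ ψ.source) :
    chartMove ψ lam s h =ᶠ[𝓝 p] ψ.symm ∘ chartMix ψ lam s h := by
  filter_upwards [hh.eventually_mem (ψ.open_source.mem_nhds hs)] with q hq
  by_cases hm : q ∈ tsupport lam
  · exact chartMove_of_mem hm
  · have : lam q = 0 := image_eq_zero_of_notMem_tsupport hm
    rw [chartMove_of_notMem hm, Function.comp, chartMix, this, zero_smul, add_zero, ψ.left_inv hq]

theorem continuousAt_chartMove (hh : ContinuousAt h p) (hs : p ∈ tsupport lam → h p ∈ ψ.source)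
    (ht : p ∈ tsupport lam → chartMix ψ lam s h p ∈ ψ.target) (hlam : ContinuousAt lam p)
    (hsc : p ∈ tsupport lam → ContinuousAt s p) : ContinuousAt (chartMove ψ lam s h) p := by
  by_cases hp : p ∈ tsupport lam
  · have h1 : ContinuousAt (ψ ∘ h) p := (ψ.continuousAt (hs hp)).comp hh
    have h2 : ContinuousAt (chartMix ψ lam s h) p := h1.add (hlam.smul ((hsc hp).sub h1))
    exact ((ψ.continuousAt_symm (ht hp)).comp h2).congr
      (chartMove_eventuallyEq hh (hs hp)).symm
  · exact hh.congr (chartMove_eventuallyEq_of_notMem hp).symm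

variable [ChartedSpace (EuclideanSpace ℝ (Fin m)) M] {EP H : Type*} [NormedAddCommGroup EP]
  [NormedSpace ℝ EP] [TopologicalSpace H] {J : ModelWithCorners ℝ EP H}
  [ChartedSpace H P]

theorem contMDiffAt_chartMix [IsManifold (𝓡 m) ∞ M]
    (hψ : ψ ∈ IsManifold.maximalAtlas (𝓡 m) ∞ M) (hs : h p ∈ ψ.source)
    (hh : ContMDiffAt J (𝓡 m) ∞ h p) (hlam : ContMDiffAt J 𝓘(ℝ, ℝ) ∞ lam p)
    (hsc : ContMDiffAt J (𝓡 m) ∞ s p) : ContMDiffAt J (𝓡 m) ∞ (chartMix ψ lam s h) p := by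
  have h1 : ContMDiffAt J (𝓡 m) ∞ (ψ ∘ h) p :=
    (contMDiffAt_of_mem_maximalAtlas hψ hs).comp p hh
  exact h1.add (hlam.smul (hsc.sub h1))

theorem contMDiffAt_chartMove [IsManifold (𝓡 m) ∞ M]
    (hψ : ψ ∈ IsManifold.maximalAtlas (𝓡 m) ∞ M) (hh : ContinuousAt h p)
    (hs : p ∈ tsupport lam → h p ∈ ψ.source)
    (ht : p ∈ tsupport lam → chartMix ψ lam s h p ∈ ψ.target)
    (h1 : p ∉ tsupport lam → ContMDiffAt J (𝓡 m) ∞ h p)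
    (h2 : p ∈ tsupport lam → ContMDiffAt J (𝓡 m) ∞ (chartMix ψ lam s h) p) :
    ContMDiffAt J (𝓡 m) ∞ (chartMove ψ lam s h) p := by
  by_cases hp : p ∈ tsupport lam
  · exact ((contMDiffAt_symm_of_mem_maximalAtlas hψ (ht hp)).comp p (h2 hp)).congr_of_eventuallyEq
      (chartMove_eventuallyEq hh (hs hp))
  · exact (h1 hp).congr_of_eventuallyEq (chartMove_eventuallyEq_of_notMem hp)

end ChartMove

/-! ### Smoothing of continuous maps -/

section Smoothing

variable {m : ℕ} {P M EP H : Type*} [NormedAddCommGroup EP] [NormedSpace ℝ EP]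
  [FiniteDimensional ℝ EP] [TopologicalSpace H] {J : ModelWithCorners ℝ EP H}
  [TopologicalSpace P] [ChartedSpace H P] [IsManifold J ∞ P] [T2Space P] [SigmaCompactSpace P]
  [TopologicalSpace M] [ChartedSpace (EuclideanSpace ℝ (Fin m)) M] [IsManifold (𝓡 m) ∞ M]

variable (J) in
/-- One chart of the smoothing procedure: `h` can be made smooth where `lam` is locally `1`, without
losing smoothness anywhere, without changes off `T i = tsupport lam`, and such that each `T j` is
still mapped into the domain of `ψ j`. In the chart `ψ i` the map is replaced by a convex
combination with a close smooth approximation. -/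
theorem exists_smoothing_step {ι : Type*} {A : Finset ι} {T : ι → Set P}
    {ψ : ι → OpenPartialHomeomorph M (EuclideanSpace ℝ (Fin m))} {h : P → M}
    (hh : Continuous h) (hT : ∀ j ∈ A, IsClosed (T j))
    (hTψ : ∀ j ∈ A, Set.MapsTo h (T j) (ψ j).source) {i : ι} (hi : i ∈ A)
    (hψ : ψ i ∈ IsManifold.maximalAtlas (𝓡 m) ∞ M) {lam : P → ℝ}
    (hlam : ContMDiff J 𝓘(ℝ, ℝ) ∞ lam) (h01 : ∀ p, lam p ∈ Set.Icc (0 : ℝ) 1)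
    (hlT : tsupport lam = T i) (hc : HasCompactSupport lam) :
    ∃ h' : P → M, Continuous h' ∧ (∀ j ∈ A, Set.MapsTo h' (T j) (ψ j).source) ∧
      (∀ p ∉ T i, h' p = h p) ∧
      (∀ p, ContMDiffAt J (𝓡 m) ∞ h p → ContMDiffAt J (𝓡 m) ∞ h' p) ∧
      ∀ p, lam =ᶠ[𝓝 p] 1 → ContMDiffAt J (𝓡 m) ∞ h' p := by
  have : LocallyCompactSpace P := Manifold.locallyCompact_of_finiteDimensional J
  have hTi : IsCompact (T i) := hlT ▸ hc
  have hsrc : ∀ p ∈ T i, h p ∈ (ψ i).source := hTψ i hi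
  -- vectors by which the map may be moved in the chart without leaving the other chart domains
  have hev : ∀ᶠ v : EuclideanSpace ℝ (Fin m) in 𝓝 0, ∀ p ∈ T i,
      ψ i (h p) + v ∈ (ψ i).target ∧
        ∀ j ∈ A, p ∈ T j → (ψ i).symm (ψ i (h p) + v) ∈ (ψ j).source := by
    refine hTi.eventually_forall_of_forall_eventually fun p hp => ?_
    have hc1 : ContinuousAt (fun q : EuclideanSpace ℝ (Fin m) × P => ψ i (h q.2) + q.1)
        (0, p) := by
      have h1 : ContinuousAt (fun p => ψ i (h p)) p :=
        ((ψ i).continuousAt (hsrc p hp)).comp hh.continuousAt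
      exact (h1.comp_of_eq (f := Prod.snd) continuousAt_snd rfl).add continuousAt_fst
    have h0 : ψ i (h p) + 0 ∈ (ψ i).target := by
      rw [add_zero]; exact (ψ i).map_source (hsrc p hp)
    refine (hc1.eventually_mem ((ψ i).open_target.mem_nhds h0)).and
      ((Filter.eventually_all_finset A).2 fun j hj => ?_)
    by_cases hpj : p ∈ T j
    · have hc2 := ((ψ i).continuousAt_symm h0).comp_of_eq hc1 rfl
      have h3 : ((ψ i).symm ∘ fun q : EuclideanSpace ℝ (Fin m) × P => ψ i (h q.2) + q.1) (0, p) ∈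
          (ψ j).source := by
        simpa [(ψ i).left_inv (hsrc p hp)] using hTψ j hj hpj
      exact (hc2.eventually_mem ((ψ j).open_source.mem_nhds h3)).mono fun _ hq _ => hq
    · filter_upwards [continuousAt_snd.eventually_mem ((hT j hj).isOpen_compl.mem_nhds hpj)]
        with q hq hq'
      exact absurd hq' hq
  obtain ⟨ε, hε, hball⟩ := Metric.eventually_nhds_iff.1 hev
  -- a smooth approximation of the map read in the chart, which is only defined near `T i` and has
  -- to be extended to `P` first
  obtain ⟨g, hg⟩ : ∃ g : C(P, EuclideanSpace ℝ (Fin m)),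
      g.restrict (T i) = ⟨fun p => ψ i (h p), ((ψ i).continuousOn.comp hh.continuousOn
        hsrc).domRestrict⟩ := ContinuousMap.exists_restrict_eq (hT i hi) _
  have hgT : ∀ p ∈ T i, g p = ψ i (h p) := fun p hp => DFunLike.congr_fun hg ⟨p, hp⟩
  obtain ⟨s, hs, -⟩ := g.continuous.exists_contMDiff_approx J (⊤ : ℕ∞) (ε := fun _ => ε)
    continuous_const fun _ => hε
  have hsm : ∀ p, ContMDiffAt J (𝓡 m) ∞ s p := fun p => s.contMDiff.contMDiffAt
  have hmix : ∀ p ∈ T i, chartMix (ψ i) lam s h p ∈ (ψ i).target ∧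
      ∀ j ∈ A, p ∈ T j → (ψ i).symm (chartMix (ψ i) lam s h p) ∈ (ψ j).source := by
    intro p hp
    refine hball ?_ p hp
    have h1 : ‖s p - ψ i (h p)‖ < ε := by
      rw [← dist_eq_norm, ← hgT p hp]
      exact hs p
    rw [dist_zero_right, norm_smul, Real.norm_eq_abs, abs_of_nonneg (h01 p).1]
    exact (mul_le_of_le_one_left (norm_nonneg _) (h01 p).2).trans_lt h1
  have hsrc' : ∀ p ∈ tsupport lam, h p ∈ (ψ i).source := fun p hp => hsrc p (hlT ▸ hp)
  have htgt' : ∀ p ∈ tsupport lam, chartMix (ψ i) lam s h p ∈ (ψ i).target :=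
    fun p hp => (hmix p (hlT ▸ hp)).1
  refine ⟨chartMove (ψ i) lam s h, ?_, ?_, ?_, ?_, ?_⟩
  · exact continuous_iff_continuousAt.2 fun p => continuousAt_chartMove hh.continuousAt (hsrc' p)
      (htgt' p) hlam.continuous.continuousAt fun _ => (hsm p).continuousAt
  · intro j hj p hp
    by_cases hpi : p ∈ T i
    · rw [chartMove_of_mem (hlT ▸ hpi)]
      exact (hmix p hpi).2 j hj hp
    · rw [chartMove_of_notMem (hlT ▸ hpi)]
      exact hTψ j hj hp
  · intro p hp
    exact chartMove_of_notMem (hlT ▸ hp)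
  · intro p hp
    exact contMDiffAt_chartMove hψ hh.continuousAt (hsrc' p) (htgt' p) (fun _ => hp) fun hp' =>
      contMDiffAt_chartMix hψ (hsrc' p hp') hp hlam.contMDiffAt (hsm p)
  · intro p hp
    have hpT : p ∈ tsupport lam := subset_tsupport _ (by simp [hp.eq_of_nhds])
    exact contMDiffAt_chartMove hψ hh.continuousAt (hsrc' p) (htgt' p)
      (fun h => absurd hpT h) fun _ => (hsm p).congr_of_eventuallyEq
        (hp.mono fun q hq => chartMix_of_eq_one hq)

/-- A continuous map that is smooth off a compact set `C` can be replaced by a smooth map without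
changing it on a closed set disjoint from `C`. -/
theorem exists_contMDiff_eqOn {h : P → M} (hh : Continuous h) {C S : Set P} (hC : IsCompact C)
    (hS : IsClosed S) (hCS : Disjoint C S) (hsm : ∀ p ∉ C, ContMDiffAt J (𝓡 m) ∞ h p) :
    ∃ h' : P → M, ContMDiff J (𝓡 m) ∞ h' ∧ Set.EqOn h' h S := by
  classical
  let ψ : P → OpenPartialHomeomorph M (EuclideanSpace ℝ (Fin m)) := fun c => chartAt _ (h c)
  have hb : ∀ c ∈ C, ∃ lam : SmoothBumpFunction J c, tsupport lam ⊆ Sᶜ ∩ h ⁻¹' (ψ c).source := by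
    intro c hc
    have hU : Sᶜ ∩ h ⁻¹' (ψ c).source ∈ 𝓝 c := Filter.inter_mem
      (hS.isOpen_compl.mem_nhds (hCS.notMem_of_mem_left hc))
      (hh.continuousAt ((ψ c).open_source.mem_nhds (mem_chart_source _ _)))
    obtain ⟨lam, -, hl⟩ := (SmoothBumpFunction.nhds_basis_tsupport c :
      (𝓝 c).HasBasis (fun _ : SmoothBumpFunction J c => True) fun f => tsupport f).mem_iff.1 hU
    exact ⟨lam, hl⟩
  choose! lam hlam using hb
  obtain ⟨A, hAC, hA⟩ := hC.elim_nhds_subcover (fun c => {p | lam c =ᶠ[𝓝 p] 1})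
    fun c _ => ((lam c).eventuallyEq_one).eventually_nhds
  -- induction over the bump functions; every intermediate map still sends all the supports into the
  -- chart domains chosen for `h`
  have key : ∀ B ⊆ A, ∃ h' : P → M, Continuous h' ∧
      (∀ c ∈ A, Set.MapsTo h' (tsupport (lam c)) (ψ c).source) ∧ Set.EqOn h' h S ∧
      (∀ p, ContMDiffAt J (𝓡 m) ∞ h p → ContMDiffAt J (𝓡 m) ∞ h' p) ∧
      ∀ c ∈ B, ∀ p, lam c =ᶠ[𝓝 p] 1 → ContMDiffAt J (𝓡 m) ∞ h' p := by
    intro B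
    induction B using Finset.induction_on with
    | empty =>
      exact fun _ => ⟨h, hh, fun c hc p hp => (hlam c (hAC c hc) hp).2, fun _ _ => rfl,
        fun _ => id, by simp⟩
    | insert b B _ ih =>
      intro hB
      obtain ⟨hb, hB⟩ := Finset.insert_subset_iff.1 hB
      obtain ⟨h', h1, h2, h3, h4, h5⟩ := ih hB
      obtain ⟨k, k1, k2, k3, k4, k5⟩ := exists_smoothing_step J (T := fun c => tsupport (lam c)) h1
        (fun c _ => isClosed_tsupport _) h2 hb (IsManifold.chart_mem_maximalAtlas (h b))
        (lam b).contMDiff (fun p => (lam b).mem_Icc) rfl (lam b).hasCompactSupport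
      refine ⟨k, k1, k2, fun p hp => ?_, fun p hp => k4 p (h4 p hp), ?_⟩
      · rw [k3 p fun hp' => (hlam b (hAC b hb) hp').1 hp, h3 hp]
      · intro c hc p hp
        rcases Finset.mem_insert.1 hc with rfl | hc
        · exact k5 p hp
        · exact k4 p (h5 c hc p hp)
  obtain ⟨h', -, -, h3, h4, h5⟩ := key A subset_rfl
  refine ⟨h', fun p => ?_, h3⟩
  by_cases hp : p ∈ C
  · obtain ⟨c, hc, hcp⟩ := Set.mem_iUnion₂.1 (hA hp)
    exact h5 c hc p hcp
  · exact h4 p (hsm p hp)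

end Smoothing

/-! ### Smoothing of homotopies -/

section SmoothPaths

theorem tsupport_comp_snd_subset {A N : Type*} [TopologicalSpace A] [TopologicalSpace N]
    (lam : N → ℝ) : tsupport (fun q : A × N => lam q.2) ⊆ Prod.snd ⁻¹' tsupport lam :=
  closure_minimal (fun _ hq => subset_tsupport lam hq)
    ((isClosed_tsupport lam).preimage continuous_snd)

variable {n m : ℕ} {N M : Type*}
  [TopologicalSpace N] [ChartedSpace (EuclideanSpace ℝ (Fin n)) N] [T2Space N]
  [TopologicalSpace M] [ChartedSpace (EuclideanSpace ℝ (Fin m)) M]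

theorem exists_bump_tsupport_subset {x : N} {U : Set N} (hU : U ∈ 𝓝 x) :
    ∃ lam : SmoothBumpFunction (𝓡 n) x, tsupport lam ⊆ U := by
  obtain ⟨lam, -, h⟩ := (SmoothBumpFunction.nhds_basis_tsupport x : (𝓝 x).HasBasis
    (fun _ : SmoothBumpFunction (𝓡 n) x => True) fun f => tsupport f).mem_iff.1 hU
  exact ⟨lam, h⟩

variable [IsManifold (𝓡 n) ∞ N] [IsManifold (𝓡 m) ∞ M]

/-- Smooth maps that are homotopic relative to `x` are joined by a path in the `C^∞` topology along
which the value at `x` is constant. -/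
theorem exists_path_of_homotopicRel [CompactSpace N] {f g : C^∞⟮𝓡 n, N; 𝓡 m, M⟯} {x : N}
    (hfg : (toContinuousMap f).HomotopicRel (toContinuousMap g) {x}) :
    ∃ F : Path f g, ∀ t, F t x = f x := by
  obtain ⟨K⟩ := hfg
  have hK0 : ∀ z, K (0, z) = f z := fun z => K.apply_zero z
  have hK1 : ∀ z, K (1, z) = g z := fun z => K.apply_one z
  have hKx : ∀ t, K (t, x) = f x := fun t => K.eq_fst t (Set.mem_singleton x)
  have hgx : g x = f x := by rw [← hK1, hKx]
  -- the homotopy, made stationary near its ends and defined for all real times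
  let h : ℝ × N → M := fun q => K (Set.projIcc 0 1 zero_le_one (3 * q.1 - 1), q.2)
  have hh : Continuous h := K.continuous.comp
    ((continuous_projIcc.comp (by fun_prop)).prodMk continuous_snd)
  have hh0 : ∀ q : ℝ × N, q.1 ≤ 1 / 3 → h q = f q.2 := fun q hq => by
    simp only [h]
    rw [Set.projIcc_of_le_left _ (by linarith)]
    exact hK0 q.2
  have hh1 : ∀ q : ℝ × N, 2 / 3 ≤ q.1 → h q = g q.2 := fun q hq => by
    simp only [h]
    rw [Set.projIcc_of_right_le _ (by linarith)]
    exact hK1 q.2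
  have hhx : ∀ t, h (t, x) = f x := fun t => hKx _
  let ψ := chartAt (EuclideanSpace ℝ (Fin m)) (f x)
  have hψ : ψ ∈ IsManifold.maximalAtlas (𝓡 m) ∞ M := IsManifold.chart_mem_maximalAtlas _
  have hxs : f x ∈ ψ.source := mem_chart_source _ _
  obtain ⟨r, hr, hball⟩ := Metric.isOpen_iff.1 ψ.open_target _ (ψ.map_source hxs)
  have hnhds : ∀ᶠ z in 𝓝 x, ∀ t : I, K (t, z) ∈ ψ.source ∩ ψ ⁻¹' Metric.ball (ψ (f x)) r := by
    have h1 : ∀ᶠ z in 𝓝 x, ∀ t ∈ (Set.univ : Set I),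
        K (t, z) ∈ ψ.source ∩ ψ ⁻¹' Metric.ball (ψ (f x)) r := by
      refine isCompact_univ.eventually_forall_of_forall_eventually fun t _ => ?_
      have h2 : Continuous fun q : N × I => K (q.2, q.1) := K.continuous.comp continuous_swap
      refine h2.continuousAt.eventually_mem
        ((ψ.isOpen_inter_preimage Metric.isOpen_ball).mem_nhds ?_)
      simp [hKx, hxs, hr]
    exact h1.mono fun z hz t => hz t trivial
  obtain ⟨b, hb⟩ := exists_bump_tsupport_subset (n := n) hnhds
  let lam : ℝ × N → ℝ := fun q => b q.2
  have hlam : ContMDiff (𝓘(ℝ, ℝ).prod (𝓡 n)) 𝓘(ℝ, ℝ) ∞ lam := b.contMDiff.comp contMDiff_snd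
  have hT : ∀ q ∈ tsupport lam, ∀ t : I,
      K (t, q.2) ∈ ψ.source ∩ ψ ⁻¹' Metric.ball (ψ (f x)) r := fun q hq =>
    hb (tsupport_comp_snd_subset _ hq)
  have hTh : ∀ q ∈ tsupport lam, h q ∈ ψ.source ∩ ψ ⁻¹' Metric.ball (ψ (f x)) r :=
    fun q hq => hT q hq _
  have hTf : ∀ q ∈ tsupport lam, f q.2 ∈ ψ.source ∩ ψ ⁻¹' Metric.ball (ψ (f x)) r :=
    fun q hq => by simpa only [hK0] using hT q hq 0
  have hTg : ∀ q ∈ tsupport lam, g q.2 ∈ ψ.source ∩ ψ ⁻¹' Metric.ball (ψ (f x)) r :=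
    fun q hq => by simpa only [hK1] using hT q hq 1
  -- near `x` the homotopy is replaced by a smooth one, which is straight in the chart
  let θ : ℝ → ℝ := fun t => Real.smoothTransition (3 * t - 1)
  have hθ : ContDiff ℝ ∞ θ := Real.smoothTransition.contDiff.comp (by fun_prop)
  let s : ℝ × N → EuclideanSpace ℝ (Fin m) := fun q =>
    ψ (f q.2) + θ q.1 • (ψ (g q.2) - ψ (f q.2))
  have hs : ∀ q ∈ tsupport lam, ContMDiffAt (𝓘(ℝ, ℝ).prod (𝓡 n)) (𝓡 m) ∞ s q := by
    intro q hq
    have h1 : ContMDiffAt (𝓘(ℝ, ℝ).prod (𝓡 n)) (𝓡 m) ∞ (fun q : ℝ × N => ψ (f q.2)) q :=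
      (contMDiffAt_of_mem_maximalAtlas hψ (hTf q hq).1).comp (f := fun q : ℝ × N => f q.2) q
        (f.contMDiff.contMDiffAt.comp q contMDiffAt_snd)
    have h2 : ContMDiffAt (𝓘(ℝ, ℝ).prod (𝓡 n)) (𝓡 m) ∞ (fun q : ℝ × N => ψ (g q.2)) q :=
      (contMDiffAt_of_mem_maximalAtlas hψ (hTg q hq).1).comp (f := fun q : ℝ × N => g q.2) q
        (g.contMDiff.contMDiffAt.comp q contMDiffAt_snd)
    have h3 : ContMDiffAt (𝓘(ℝ, ℝ).prod (𝓡 n)) 𝓘(ℝ, ℝ) ∞ (fun q : ℝ × N => θ q.1) q :=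
      hθ.contMDiff.contMDiffAt.comp q contMDiffAt_fst
    exact h1.add (h3.smul (h2.sub h1))
  have hsb : ∀ q ∈ tsupport lam, s q ∈ Metric.ball (ψ (f x)) r := fun q hq =>
    (convex_ball _ _).add_smul_sub_mem (hTf q hq).2 (hTg q hq).2
      ⟨Real.smoothTransition.nonneg _, Real.smoothTransition.le_one _⟩
  have hmix : ∀ q ∈ tsupport lam, chartMix ψ lam s h q ∈ ψ.target := fun q hq =>
    hball ((convex_ball _ _).add_smul_sub_mem (hTh q hq).2 (hsb q hq) b.mem_Icc)
  let k : ℝ × N → M := chartMove ψ lam s h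
  have hk : Continuous k := continuous_iff_continuousAt.2 fun q =>
    continuousAt_chartMove hh.continuousAt (fun hq => (hTh q hq).1) (hmix q)
      hlam.continuous.continuousAt fun hq => (hs q hq).continuousAt
  have hksm : ∀ q, ContMDiffAt (𝓘(ℝ, ℝ).prod (𝓡 n)) (𝓡 m) ∞ h q →
      ContMDiffAt (𝓘(ℝ, ℝ).prod (𝓡 n)) (𝓡 m) ∞ k q := fun q hq =>
    contMDiffAt_chartMove hψ hh.continuousAt (fun hq => (hTh q hq).1) (hmix q) (fun _ => hq)
      fun hq' => contMDiffAt_chartMix hψ (hTh q hq').1 hq hlam.contMDiffAt (hs q hq')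
  -- now the homotopy is smooth except for times in `[1/3, 2/3]` and points outside the
  -- neighbourhood `V` of `x`, and it can be smoothed there without changes at the end times and
  -- at `x`
  let V : Set N := {z | b =ᶠ[𝓝 z] 1}
  have hV : IsOpen V := isOpen_setOfPred_eventually_nhds
  have hxV : x ∈ V := b.eventuallyEq_one
  obtain ⟨k', hk', hkk⟩ := exists_contMDiff_eqOn (J := 𝓘(ℝ, ℝ).prod (𝓡 n)) hk
    (C := Set.Icc (1 / 3) (2 / 3) ×ˢ Vᶜ) (S := {q | q.1 ≤ 0 ∨ 1 ≤ q.1 ∨ q.2 = x})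
    (isCompact_Icc.prod hV.isClosed_compl.isCompact)
    ((isClosed_le continuous_fst continuous_const).union
      ((isClosed_le continuous_const continuous_fst).union
        (isClosed_singleton.preimage continuous_snd)))
    (by
      rw [Set.disjoint_left]
      rintro ⟨t, z⟩ ⟨ht, hz⟩ (h0 | h1 | rfl)
      · exact absurd (ht.1.trans h0) (by norm_num)
      · exact absurd (h1.trans ht.2) (by norm_num)
      · exact hz hxV)
    (by
      intro q hq
      by_cases hqV : q.2 ∈ V
      · have h1 : lam =ᶠ[𝓝 q] 1 := continuous_snd.continuousAt.eventually hqV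
        have hqT : q ∈ tsupport lam := subset_tsupport _ (by simp [h1.eq_of_nhds])
        exact contMDiffAt_chartMove hψ hh.continuousAt (fun hq => (hTh q hq).1) (hmix q)
          (fun h => absurd hqT h) fun _ => (hs q hqT).congr_of_eventuallyEq
            (h1.mono fun _ hp => chartMix_of_eq_one hp)
      · refine hksm q ?_
        have : q.1 < 1 / 3 ∨ 2 / 3 < q.1 := by
          by_contra! hc
          exact hq ⟨hc, hqV⟩
        rcases this with hlt | hlt
        · have h1 : h =ᶠ[𝓝 q] fun q => f q.2 := by
            filter_upwards [continuous_fst.continuousAt.eventually_mem (Iio_mem_nhds hlt)]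
              with p hp using hh0 p (le_of_lt hp)
          exact (f.contMDiff.contMDiffAt.comp q contMDiffAt_snd).congr_of_eventuallyEq h1
        · have h1 : h =ᶠ[𝓝 q] fun q => g q.2 := by
            filter_upwards [continuous_fst.continuousAt.eventually_mem (Ioi_mem_nhds hlt)]
              with p hp using hh1 p (le_of_lt hp)
          exact (g.contMDiff.contMDiffAt.comp q contMDiffAt_snd).congr_of_eventuallyEq h1)
  have hk0 : ∀ z, k' (0, z) = f z := fun z => by
    rw [hkk (.inl le_rfl), ← hh0 (0, z) (by norm_num)]
    refine chartMove_of_eq (fun hq => (hTh _ hq).1) ?_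
    have : θ 0 = 0 := Real.smoothTransition.zero_of_nonpos (by norm_num)
    simp [s, this, hh0 (0, z) (by norm_num)]
  have hk1 : ∀ z, k' (1, z) = g z := fun z => by
    rw [hkk (.inr (.inl le_rfl)), ← hh1 (1, z) (by norm_num)]
    refine chartMove_of_eq (fun hq => (hTh _ hq).1) ?_
    have : θ 1 = 1 := Real.smoothTransition.one_of_one_le (by norm_num)
    simp [s, this, hh1 (1, z) (by norm_num)]
  have hkx : ∀ t, k' (t, x) = f x := fun t => by
    rw [hkk (.inr (.inr rfl)), ← hhx t]
    refine chartMove_of_eq (fun hq => (hTh _ hq).1) ?_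
    simp [s, hgx, hhx]
  let F : I → C^∞⟮𝓡 n, N; 𝓡 m, M⟯ := fun t =>
    ⟨fun z => k' (t, z), hk'.comp (contMDiff_const.prodMk contMDiff_id)⟩
  have hF : Continuous F := continuous_iff_continuousAt.2 fun t =>
    continuousAt_smoothFamily continuous_subtype_val.continuousAt (fun _ _ => rfl)
      fun _ => hk'.contMDiffAt
  exact ⟨⟨⟨F, hF⟩, ContMDiffMap.ext hk0, ContMDiffMap.ext hk1⟩, fun t => hkx t⟩

/-! ### Lifting paths along evaluation maps -/

/-- Moving the value of `f` at `ρ` inside a chart ball: `f` is translated in the chart near `ρ`,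
with a cutoff. The ball of radius `3 * r` contains the translates of the ball of radius `r` by the
differences of its points. -/
theorem exists_continuous_family_of_chart {X : Type*} [TopologicalSpace X]
    (f : C^∞⟮𝓡 n, N; 𝓡 m, M⟯) (ρ : N)
    {ψ : OpenPartialHomeomorph M (EuclideanSpace ℝ (Fin m))}
    (hψ : ψ ∈ IsManifold.maximalAtlas (𝓡 m) ∞ M) {c : EuclideanSpace ℝ (Fin m)} {r : ℝ}
    (hball : Metric.ball c (3 * r) ⊆ ψ.target)
    (hρ : f ρ ∈ ψ.source ∩ ψ ⁻¹' Metric.ball c r) {d : X → M} (hd : Continuous d)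
    (hdc : ∀ a, d a ∈ ψ.source ∩ ψ ⁻¹' Metric.ball c r) :
    ∃ F : X → C^∞⟮𝓡 n, N; 𝓡 m, M⟯, Continuous F ∧ (∀ a, F a ρ = d a) ∧
      ∀ a, d a = f ρ → F a = f := by
  obtain ⟨b, hb⟩ := exists_bump_tsupport_subset (n := n)
    (f.contMDiff.continuous.continuousAt.eventually_mem
      ((ψ.isOpen_inter_preimage Metric.isOpen_ball).mem_nhds hρ))
  let lam : EuclideanSpace ℝ (Fin m) × N → ℝ := fun q => b q.2
  let s : EuclideanSpace ℝ (Fin m) × N → EuclideanSpace ℝ (Fin m) := fun q => ψ (f q.2) + q.1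
  let h : EuclideanSpace ℝ (Fin m) × N → M := fun q => f q.2
  have hh : ContMDiff (𝓘(ℝ, EuclideanSpace ℝ (Fin m)).prod (𝓡 n)) (𝓡 m) ∞ h :=
    f.contMDiff.comp contMDiff_snd
  have hlam : ContMDiff (𝓘(ℝ, EuclideanSpace ℝ (Fin m)).prod (𝓡 n)) 𝓘(ℝ, ℝ) ∞ lam :=
    b.contMDiff.comp contMDiff_snd
  have hT : ∀ q ∈ tsupport lam, h q ∈ ψ.source ∩ ψ ⁻¹' Metric.ball c r := fun q hq =>
    hb (tsupport_comp_snd_subset _ hq)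
  have hmixeq : ∀ q, chartMix ψ lam s h q = ψ (f q.2) + b q.2 • q.1 := fun q => by
    simp [chartMix, s, h, lam]
  have hG : ∀ q : EuclideanSpace ℝ (Fin m) × N, ‖q.1‖ < 2 * r →
      ContMDiffAt (𝓘(ℝ, EuclideanSpace ℝ (Fin m)).prod (𝓡 n)) (𝓡 m) ∞
        (chartMove ψ lam s h) q := by
    intro q hq
    refine contMDiffAt_chartMove hψ hh.continuous.continuousAt (fun hq => (hT q hq).1)
      (fun hq' => hball ?_) (fun _ => hh.contMDiffAt) (fun hq' =>
        contMDiffAt_chartMix hψ (hT q hq').1 hh.contMDiffAt hlam.contMDiffAt ?_)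
    · have h1 : dist (ψ (f q.2)) c < r := (hT q hq').2
      have h2 : ‖b q.2 • q.1‖ ≤ ‖q.1‖ := by
        rw [norm_smul, Real.norm_eq_abs, abs_of_nonneg b.nonneg]
        exact mul_le_of_le_one_left (norm_nonneg _) b.le_one
      rw [dist_eq_norm] at h1
      rw [hmixeq, Metric.mem_ball, dist_eq_norm, add_sub_right_comm]
      linarith [norm_add_le (ψ (f q.2) - c) (b q.2 • q.1)]
    · exact ContMDiffAt.add ((contMDiffAt_of_mem_maximalAtlas hψ (hT q hq').1).comp q
        hh.contMDiffAt) contMDiffAt_fst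
  -- the displacement, in the chart, that takes the value at `ρ` to `d a`
  let u : X → EuclideanSpace ℝ (Fin m) := fun a => ψ (d a) - ψ (f ρ)
  have hu : Continuous u := by
    refine Continuous.sub (continuous_iff_continuousAt.2 fun a => ?_) continuous_const
    exact (ψ.continuousAt (hdc a).1).comp hd.continuousAt
  have hur : ∀ a, ‖u a‖ < 2 * r := fun a => by
    have h1 : dist (ψ (d a)) c < r := (hdc a).2
    have h2 : dist (ψ (f ρ)) c < r := hρ.2
    rw [← dist_eq_norm]
    linarith [dist_triangle_right (ψ (d a)) (ψ (f ρ)) c]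
  refine ⟨fun a => ⟨fun z => chartMove ψ lam s h (u a, z), fun z =>
    (hG (u a, z) (hur a)).comp z (contMDiffAt_const.prodMk contMDiffAt_id)⟩,
    continuous_iff_continuousAt.2 fun a => continuousAt_smoothFamily hu.continuousAt
      (fun _ _ => rfl) fun z => hG _ (hur a), fun a => ?_, fun a ha => ?_⟩
  · have hm : (u a, ρ) ∈ tsupport lam := subset_tsupport _ (by simp [lam])
    change chartMove ψ lam s h (u a, ρ) = d a
    rw [chartMove_of_mem hm, hmixeq]
    simp [u, ψ.left_inv (hdc a).1]
  · ext z
    exact chartMove_of_eq (fun hq => (hT _ hq).1) (by simp [s, h, u, ha])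

/-- Path lifting for the evaluation map `f ↦ f ρ` on the space of smooth maps: any path in `M` that
starts at `f ρ` is the track of `ρ` under a path of smooth maps that starts at `f`. -/
theorem exists_lift_eval (f : C^∞⟮𝓡 n, N; 𝓡 m, M⟯) (ρ : N) {y : M} (c : Path (f ρ) y) :
    ∃ F : C(I, C^∞⟮𝓡 n, N; 𝓡 m, M⟯), F 0 = f ∧ ∀ t, F t ρ = c t := by
  have hb : ∀ p : M, ∃ r > 0, Metric.ball (chartAt (EuclideanSpace ℝ (Fin m)) p p) (3 * r) ⊆
      (chartAt (EuclideanSpace ℝ (Fin m)) p).target := by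
    intro p
    obtain ⟨r, hr, h⟩ := Metric.isOpen_iff.1 (chartAt (EuclideanSpace ℝ (Fin m)) p).open_target _
      ((chartAt (EuclideanSpace ℝ (Fin m)) p).map_source (mem_chart_source _ p))
    exact ⟨r / 3, by positivity, by rwa [mul_div_cancel₀ r three_ne_zero]⟩
  choose r hr hball using hb
  let U : M → Set M := fun p => (chartAt (EuclideanSpace ℝ (Fin m)) p).source ∩
    chartAt (EuclideanSpace ℝ (Fin m)) p ⁻¹'
      Metric.ball (chartAt (EuclideanSpace ℝ (Fin m)) p p) (r p)
  have hU : ∀ p, IsOpen (U p) := fun p =>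
    (chartAt (EuclideanSpace ℝ (Fin m)) p).isOpen_inter_preimage Metric.isOpen_ball
  obtain ⟨τ, hτ0, hτ, ⟨k, hk⟩, hcov⟩ := exists_monotone_Icc_subset_open_cover_unitInterval
    (c := fun p => c ⁻¹' U p) (fun p => (hU p).preimage c.continuous) fun t _ =>
      Set.mem_iUnion.2 ⟨c t, mem_chart_source _ _, Metric.mem_ball_self (hr _)⟩
  -- lift on `[0, τ j]`; after the time `τ j` the path is stationary
  have key : ∀ j, ∃ F : C(I, C^∞⟮𝓡 n, N; 𝓡 m, M⟯), F 0 = f ∧ ∀ t, F t ρ = c (min t (τ j)) := by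
    intro j
    induction j with
    | zero => exact ⟨.const _ f, rfl, fun t => by simp [hτ0]⟩
    | succ j ih =>
      obtain ⟨F, hF0, hF⟩ := ih
      obtain ⟨p, hp⟩ := hcov j
      have hle : τ j ≤ τ (j + 1) := hτ (Nat.le_succ j)
      have hFj : F (τ j) ρ = c (τ j) := by rw [hF, min_self]
      obtain ⟨G, hG, hGd, hGf⟩ := exists_continuous_family_of_chart (F (τ j)) ρ
        (IsManifold.chart_mem_maximalAtlas p) (hball p) (hFj ▸ hp ⟨le_rfl, hle⟩)
        (d := fun t : I => c (max (τ j) (min t (τ (j + 1))))) (by fun_prop)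
        fun t => hp ⟨le_max_left _ _, max_le hle (min_le_right _ _)⟩
      refine ⟨⟨fun t => if t ≤ τ j then F t else G t, Continuous.if_le F.continuous hG
        continuous_id continuous_const fun t ht => ?_⟩, ?_, fun t => ?_⟩
      · subst ht
        exact (hGf _ (by rw [hFj, min_eq_left hle, max_self])).symm
      · simp [show (0 : I) ≤ τ j from (τ j).2.1, hF0]
      · by_cases ht : t ≤ τ j
        · simp [ht, hF, min_eq_left (ht.trans hle)]
        · simp [ht, hGd, (not_le.1 ht).le, hle]
  obtain ⟨F, hF0, hF⟩ := key k
  refine ⟨F, hF0, fun t => ?_⟩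
  rw [hF, hk k le_rfl, min_eq_left (show t ≤ 1 from t.2.2)]

end SmoothPaths

/-! ### Paths of smooth maps and the actions of the fundamental groups -/

/-- The element of the fundamental group represented by a loop. -/
abbrev loopClass {Y : Type*} [TopologicalSpace Y] {y : Y} (p : Path y y) : FundamentalGroup Y y :=
  FundamentalGroup.fromPath (Path.Homotopic.Quotient.mk p)

theorem exists_loopClass_eq {Y : Type*} [TopologicalSpace Y] {y : Y} (β : FundamentalGroup Y y) :
    ∃ p : Path y y, loopClass p = β :=
  Path.Homotopic.Quotient.mk_surjective β.toPath

theorem joined_apply_zero {X : Type*} [TopologicalSpace X] (F : C(I, X)) (t : I) :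
    Joined (F 0) (F t) := by
  have : PathConnectedSpace I := isPathConnected_iff_pathConnectedSpace.1
    ((convex_Icc (0 : ℝ) 1).isPathConnected ⟨0, by simp⟩)
  exact (PathConnectedSpace.joined (0 : I) t).map F.continuous

section Loops

variable {n m : ℕ} {N M : Type*}
  [TopologicalSpace N] [ChartedSpace (EuclideanSpace ℝ (Fin n)) N] [IsManifold (𝓡 n) ∞ N]
  [TopologicalSpace M] [ChartedSpace (EuclideanSpace ℝ (Fin m)) M] [IsManifold (𝓡 m) ∞ M]

theorem continuous_eval_family (F : C(I, C^∞⟮𝓡 n, N; 𝓡 m, M⟯)) :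
    Continuous fun q : I × N => F q.1 q.2 := by
  have : LocallyCompactSpace N := ChartedSpace.locallyCompactSpace (EuclideanSpace ℝ (Fin n)) N
  exact ContinuousMap.continuous_uncurry_of_continuous
    ⟨fun t => toContinuousMap (F t), continuous_toContinuousMap.comp F.continuous⟩

variable [T2Space N] {φ : C^∞⟮𝓡 n, N; 𝓡 m, M⟯} {x : N} {y : M}

/-- If along a homotopy `F` of maps `N → M` the image of a loop `p` in `N`, with the two parameters
taken equal, is the loop `c` in `M`, then `[F 1] [p] = [c] [F 0]`. For a homotopy `K` of the
identity along `p`, the maps `F t ∘ K t` form a homotopy along `c` from `F 0` to `F 1 ∘ K 1`. -/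
theorem op_smul_eq_smul_of_track [WellPointed x] (F : C(I, C^∞⟮𝓡 n, N; 𝓡 m, M⟯)) (p : Path x x)
    (c : Path y y) (hc : ∀ t, F t (p t) = c t) {f g : PointedMap x y}
    (hf : f.1 = toContinuousMap (F 0)) (hg : g.1 = toContinuousMap (F 1)) :
    MulOpposite.op (loopClass p) • PointedClass.mk g = loopClass c • PointedClass.mk f := by
  obtain ⟨K, hK0, hKx⟩ := exists_extension x (ContinuousMap.id N) p.toContinuousMap (by simp)
  let k : PointedMap x x := ⟨⟨fun z => K (1, z), by fun_prop⟩, by simp [hKx]⟩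
  have hk : loopClass p • PointedClass.id x = PointedClass.mk k :=
    smul_eq_iff.2 ⟨p, ⟨.id N, rfl⟩, k, rfl, rfl, rfl, ⟨K, hK0, fun _ => rfl⟩, hKx⟩
  have h1 : MulOpposite.op (loopClass p) • PointedClass.mk g =
      (PointedClass.mk g).comp (loopClass p • PointedClass.id x) := rfl
  rw [h1, hk, eq_comm, smul_eq_iff]
  refine ⟨c, f, ⟨g.1.comp k.1, by simp [k.2, g.2]⟩, rfl, rfl, rfl,
    ⟨⟨fun q => F q.1 (K q), (continuous_eval_family F).comp
      (continuous_fst.prodMk K.continuous)⟩, fun z => ?_, fun z => ?_⟩, fun t => ?_⟩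
  · simp [hK0, hf, toContinuousMap]
  · simp [hg, toContinuousMap, k]
  · change F t (K (t, x)) = c t
    rw [hKx]
    exact hc t

/-- The right action of `[p] ∈ π₁(N)` on the class of `f` agrees with the left action of the loop
`f ∘ p`. -/
theorem op_smul_toPointedClass [WellPointed x] (f : PointedComponent φ x y) (p : Path x x)
    (c : Path y y) (hc : ∀ t, f.1 (p t) = c t) :
    MulOpposite.op (loopClass p) • toPointedClass φ x y (.mk f) =
      loopClass c • toPointedClass φ x y (.mk f) :=
  op_smul_eq_smul_of_track (.const _ f.1) p c hc rfl rfl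

theorem toPointedClass_eq_smul_of_track [WellPointed x] (F : C(I, C^∞⟮𝓡 n, N; 𝓡 m, M⟯))
    (c : Path y y) (hc : ∀ t, F t x = c t) {f g : PointedComponent φ x y}
    (hf : F 0 = f.1) (hg : F 1 = g.1) :
    toPointedClass φ x y (.mk g) = loopClass c • toPointedClass φ x y (.mk f) := by
  have h := op_smul_eq_smul_of_track F (Path.refl x) c hc
    (f := ⟨toContinuousMap f.1, f.2.2⟩) (g := ⟨toContinuousMap g.1, g.2.2⟩) (by rw [hf])
    (by rw [hg])
  have h1 : MulOpposite.op (loopClass (Path.refl x)) = 1 := rfl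
  rwa [h1, one_smul] at h

/-- The left action of `π₁(M)` is realized by paths of smooth maps, with a given loop as the track
of the base point. -/
theorem exists_lift_loop [WellPointed x] (f : PointedComponent φ x y) (c : Path y y) :
    ∃ (F : C(I, C^∞⟮𝓡 n, N; 𝓡 m, M⟯)) (g : PointedComponent φ x y), F 0 = f.1 ∧ F 1 = g.1 ∧
      (∀ t, F t x = c t) ∧
      toPointedClass φ x y (.mk g) = loopClass c • toPointedClass φ x y (.mk f) := by
  obtain ⟨F, hF0, hF⟩ := exists_lift_eval f.1 x (c.cast f.2.2 rfl)
  have hc : ∀ t, F t x = c t := hF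
  refine ⟨F, ⟨F 1, (joined_apply_zero F 1).mem_pathComponent (hF0 ▸ f.2.1), by simp [hc]⟩, hF0,
    rfl, hc, toPointedClass_eq_smul_of_track F c hc hF0 rfl⟩

theorem isInvariant_range_toPointedClass :
    IsInvariant n x y (Set.range (toPointedClass φ x y)) := by
  have := wellPointed_of_chartedSpace n x
  have key : ∀ (β : FundamentalGroup M y), ∀ a ∈ Set.range (toPointedClass φ x y),
      β • a ∈ Set.range (toPointedClass φ x y) := by
    rintro β _ ⟨a, rfl⟩
    obtain ⟨f, rfl⟩ := ZerothHomotopy.mk_surjective a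
    obtain ⟨c, rfl⟩ := exists_loopClass_eq β
    obtain ⟨-, g, -, -, -, hg⟩ := exists_lift_loop f c
    exact ⟨.mk g, hg⟩
  refine ⟨key, ?_⟩
  rintro γ _ ⟨a, rfl⟩
  obtain ⟨f, rfl⟩ := ZerothHomotopy.mk_surjective a
  obtain ⟨p, rfl⟩ := exists_loopClass_eq γ
  rw [op_smul_toPointedClass f p ((p.map f.1.contMDiff.continuous).cast f.2.2.symm f.2.2.symm)
    fun _ => rfl]
  exact key _ _ ⟨_, rfl⟩

theorem injective_toPointedClass [CompactSpace N] :
    Function.Injective (toPointedClass φ x y) := by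
  intro a b hab
  obtain ⟨f, rfl⟩ := ZerothHomotopy.mk_surjective a
  obtain ⟨g, rfl⟩ := ZerothHomotopy.mk_surjective b
  have h : (toContinuousMap f.1).HomotopicRel (toContinuousMap g.1) {x} :=
    Quotient.exact (s := pointedHomotopy x y) hab
  obtain ⟨F, hF⟩ := exists_path_of_homotopicRel h
  refine ZerothHomotopy.sound ⟨⟨fun t => ⟨F t, ?_, (hF t).trans f.2.2⟩, by fun_prop⟩, ?_, ?_⟩
  · have h1 := joined_apply_zero F.toContinuousMap t
    exact h1.mem_pathComponent (by simpa using f.2.1)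
  · exact Subtype.ext F.source
  · exact Subtype.ext F.target

end Loops

/-! ### Path components of the coincidence space -/

section Coincidence

variable {n₁ n₂ m : ℕ} {N₁ N₂ M : Type*}
  [TopologicalSpace N₁] [ChartedSpace (EuclideanSpace ℝ (Fin n₁)) N₁]
  [TopologicalSpace N₂] [ChartedSpace (EuclideanSpace ℝ (Fin n₂)) N₂]
  [TopologicalSpace M] [ChartedSpace (EuclideanSpace ℝ (Fin m)) M]
  {φ₁ : C^∞⟮𝓡 n₁, N₁; 𝓡 m, M⟯} {φ₂ : C^∞⟮𝓡 n₂, N₂; 𝓡 m, M⟯} {x₁ : N₁} {x₂ : N₂} {y : M}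

/-- Paths of maps and of points with equal values form a path in the coincidence space. -/
theorem exists_joined_of_paths (F₁ : C(I, C^∞⟮𝓡 n₁, N₁; 𝓡 m, M⟯))
    (F₂ : C(I, C^∞⟮𝓡 n₂, N₂; 𝓡 m, M⟯)) (ρ₁ : C(I, N₁)) (ρ₂ : C(I, N₂))
    (h : ∀ t, F₁ t (ρ₁ t) = F₂ t (ρ₂ t)) {q : CoincidenceSpace φ₁ φ₂}
    (hq : q.1 = (F₁ 0, F₂ 0, ρ₁ 0, ρ₂ 0)) :
    ∃ q' : CoincidenceSpace φ₁ φ₂, q'.1 = (F₁ 1, F₂ 1, ρ₁ 1, ρ₂ 1) ∧ Joined q q' := by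
  have h1 : F₁ 0 ∈ pathComponent φ₁ := by simpa only [hq] using q.2.1
  have h2 : F₂ 0 ∈ pathComponent φ₂ := by simpa only [hq] using q.2.2.1
  let Q : C(I, CoincidenceSpace φ₁ φ₂) := ⟨fun t => ⟨(F₁ t, F₂ t, ρ₁ t, ρ₂ t),
    (joined_apply_zero F₁ t).mem_pathComponent h1, (joined_apply_zero F₂ t).mem_pathComponent h2,
    h t⟩, by fun_prop⟩
  have hQ : Q 0 = q := Subtype.ext hq.symm
  exact ⟨Q 1, rfl, hQ ▸ joined_apply_zero Q 1⟩

theorem joined_pointedInclusion_of_paths (F₁ : C(I, C^∞⟮𝓡 n₁, N₁; 𝓡 m, M⟯))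
    (F₂ : C(I, C^∞⟮𝓡 n₂, N₂; 𝓡 m, M⟯)) (ρ₁ : Path x₁ x₁) (ρ₂ : Path x₂ x₂)
    (h : ∀ t, F₁ t (ρ₁ t) = F₂ t (ρ₂ t)) {f₁ g₁ : PointedComponent φ₁ x₁ y}
    {f₂ g₂ : PointedComponent φ₂ x₂ y} (hf₁ : F₁ 0 = f₁.1) (hf₂ : F₂ 0 = f₂.1)
    (hg₁ : F₁ 1 = g₁.1) (hg₂ : F₂ 1 = g₂.1) :
    Joined (pointedInclusion φ₁ φ₂ x₁ x₂ y f₁ f₂) (pointedInclusion φ₁ φ₂ x₁ x₂ y g₁ g₂) := by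
  obtain ⟨q, hq, hj⟩ := exists_joined_of_paths F₁ F₂ ρ₁.toContinuousMap ρ₂.toContinuousMap h
    (q := pointedInclusion φ₁ φ₂ x₁ x₂ y f₁ f₂) (by simp [pointedInclusion, hf₁, hf₂])
  have : q = pointedInclusion φ₁ φ₂ x₁ x₂ y g₁ g₂ :=
    Subtype.ext (hq.trans (by simp [pointedInclusion, hg₁, hg₂]))
  exact this ▸ hj

theorem joined_pointedInclusion {f₁ g₁ : PointedComponent φ₁ x₁ y}
    {f₂ g₂ : PointedComponent φ₂ x₂ y} (h₁ : Joined f₁ g₁) (h₂ : Joined f₂ g₂) :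
    Joined (pointedInclusion φ₁ φ₂ x₁ x₂ y f₁ f₂) (pointedInclusion φ₁ φ₂ x₁ x₂ y g₁ g₂) := by
  obtain ⟨F₁⟩ := h₁
  obtain ⟨F₂⟩ := h₂
  refine joined_pointedInclusion_of_paths ⟨fun t => (F₁ t).1, by fun_prop⟩
    ⟨fun t => (F₂ t).1, by fun_prop⟩ (Path.refl _) (Path.refl _)
    (fun t => (F₁ t).2.2.trans (F₂ t).2.2.symm) ?_ ?_ ?_ ?_ <;> simp

variable [IsManifold (𝓡 n₁) ∞ N₁] [T2Space N₁] [IsManifold (𝓡 n₂) ∞ N₂] [T2Space N₂]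
  [IsManifold (𝓡 m) ∞ M]

section Moves

variable [WellPointed x₁] [WellPointed x₂]

theorem exists_joined_smul_smul (f₁ : PointedComponent φ₁ x₁ y) (f₂ : PointedComponent φ₂ x₂ y)
    (β : FundamentalGroup M y) :
    ∃ (g₁ : PointedComponent φ₁ x₁ y) (g₂ : PointedComponent φ₂ x₂ y),
      toPointedClass φ₁ x₁ y (.mk g₁) = β • toPointedClass φ₁ x₁ y (.mk f₁) ∧
      toPointedClass φ₂ x₂ y (.mk g₂) = β • toPointedClass φ₂ x₂ y (.mk f₂) ∧
      Joined (pointedInclusion φ₁ φ₂ x₁ x₂ y f₁ f₂) (pointedInclusion φ₁ φ₂ x₁ x₂ y g₁ g₂) := by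
  obtain ⟨c, rfl⟩ := exists_loopClass_eq β
  obtain ⟨F₁, g₁, hf₁, hg₁, hc₁, h₁⟩ := exists_lift_loop f₁ c
  obtain ⟨F₂, g₂, hf₂, hg₂, hc₂, h₂⟩ := exists_lift_loop f₂ c
  exact ⟨g₁, g₂, h₁, h₂, joined_pointedInclusion_of_paths F₁ F₂ (Path.refl _) (Path.refl _)
    (fun t => (hc₁ t).trans (hc₂ t).symm) hf₁ hf₂ hg₁ hg₂⟩

/-- Inside `B` the class of the first map can be multiplied by `γ ∈ π₁(N₁)` from the right while
that of the second map is kept. -/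
theorem exists_joined_op_smul_left (f₁ : PointedComponent φ₁ x₁ y)
    (f₂ : PointedComponent φ₂ x₂ y) (γ : FundamentalGroup N₁ x₁) :
    ∃ (g₁ : PointedComponent φ₁ x₁ y) (g₂ : PointedComponent φ₂ x₂ y),
      toPointedClass φ₁ x₁ y (.mk g₁) = MulOpposite.op γ • toPointedClass φ₁ x₁ y (.mk f₁) ∧
      toPointedClass φ₂ x₂ y (.mk g₂) = toPointedClass φ₂ x₂ y (.mk f₂) ∧
      Joined (pointedInclusion φ₁ φ₂ x₁ x₂ y f₁ f₂) (pointedInclusion φ₁ φ₂ x₁ x₂ y g₁ g₂) := by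
  obtain ⟨p, rfl⟩ := exists_loopClass_eq γ
  let c : Path y y := (p.map f₁.1.contMDiff.continuous).cast f₁.2.2.symm f₁.2.2.symm
  have hc : ∀ t, f₁.1 (p t) = c t := fun _ => rfl
  -- while the first point runs backwards along `p`, the second map follows, so that its class is
  -- multiplied by `[c]⁻¹`; multiplying both classes by `[c]` restores it
  obtain ⟨F₂, k₂, hf₂, hk₂, hc₂, h₂⟩ := exists_lift_loop f₂ c.symm
  have hj : Joined (pointedInclusion φ₁ φ₂ x₁ x₂ y f₁ f₂)
      (pointedInclusion φ₁ φ₂ x₁ x₂ y f₁ k₂) :=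
    joined_pointedInclusion_of_paths (.const _ f₁.1) F₂ p.symm (Path.refl _)
      (fun t => (hc₂ t).symm) rfl hf₂ rfl hk₂
  obtain ⟨g₁, g₂, h₁, h₂', hj'⟩ := exists_joined_smul_smul f₁ k₂ (loopClass c)
  refine ⟨g₁, g₂, ?_, ?_, hj.trans hj'⟩
  · rw [h₁, op_smul_toPointedClass f₁ p c hc]
  · have : loopClass c.symm = (loopClass c)⁻¹ := rfl
    rw [h₂', h₂, this, smul_inv_smul]

theorem exists_joined_op_smul_right (f₁ : PointedComponent φ₁ x₁ y)
    (f₂ : PointedComponent φ₂ x₂ y) (γ : FundamentalGroup N₂ x₂) :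
    ∃ (g₁ : PointedComponent φ₁ x₁ y) (g₂ : PointedComponent φ₂ x₂ y),
      toPointedClass φ₁ x₁ y (.mk g₁) = toPointedClass φ₁ x₁ y (.mk f₁) ∧
      toPointedClass φ₂ x₂ y (.mk g₂) = MulOpposite.op γ • toPointedClass φ₂ x₂ y (.mk f₂) ∧
      Joined (pointedInclusion φ₁ φ₂ x₁ x₂ y f₁ f₂) (pointedInclusion φ₁ φ₂ x₁ x₂ y g₁ g₂) := by
  obtain ⟨g₂, g₁, h₂, h₁, hj⟩ := exists_joined_op_smul_left f₂ f₁ γ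
  refine ⟨g₁, g₂, h₁, h₂, ?_⟩
  let swap : CoincidenceSpace φ₂ φ₁ → CoincidenceSpace φ₁ φ₂ := fun q =>
    ⟨(q.1.2.1, q.1.1, q.1.2.2.2, q.1.2.2.1), q.2.2.1, q.2.1, q.2.2.2.symm⟩
  exact hj.map (f := swap) (by fun_prop)

theorem joined_pointedInclusion_of_eq_smul [CompactSpace N₁] [CompactSpace N₂]
    {f₁ g₁ : PointedComponent φ₁ x₁ y} {f₂ g₂ : PointedComponent φ₂ x₂ y}
    (β : FundamentalGroup M y) (γ₁ : FundamentalGroup N₁ x₁) (γ₂ : FundamentalGroup N₂ x₂)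
    (h₁ : toPointedClass φ₁ x₁ y (.mk g₁) =
      MulOpposite.op γ₁ • β • toPointedClass φ₁ x₁ y (.mk f₁))
    (h₂ : toPointedClass φ₂ x₂ y (.mk g₂) =
      MulOpposite.op γ₂ • β • toPointedClass φ₂ x₂ y (.mk f₂)) :
    Joined (pointedInclusion φ₁ φ₂ x₁ x₂ y f₁ f₂) (pointedInclusion φ₁ φ₂ x₁ x₂ y g₁ g₂) := by
  obtain ⟨k₁, k₂, hk₁, hk₂, hj⟩ := exists_joined_smul_smul f₁ f₂ β
  obtain ⟨l₁, l₂, hl₁, hl₂, hj'⟩ := exists_joined_op_smul_left k₁ k₂ γ₁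
  obtain ⟨r₁, r₂, hr₁, hr₂, hj''⟩ := exists_joined_op_smul_right l₁ l₂ γ₂
  refine ((hj.trans hj').trans hj'').trans (joined_pointedInclusion ?_ ?_)
  · refine Quotient.exact (s := pathSetoid _) (injective_toPointedClass ?_)
    exact (hr₁.trans (hl₁.trans (congrArg _ hk₁))).trans h₁.symm
  · refine Quotient.exact (s := pathSetoid _) (injective_toPointedClass ?_)
    exact (hr₂.trans (congrArg _ (hl₂.trans hk₂))).trans h₂.symm

theorem exists_eq_smul_of_joined_pointedInclusion
    {f₁ g₁ : PointedComponent φ₁ x₁ y} {f₂ g₂ : PointedComponent φ₂ x₂ y}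
    (h : Joined (pointedInclusion φ₁ φ₂ x₁ x₂ y f₁ f₂)
      (pointedInclusion φ₁ φ₂ x₁ x₂ y g₁ g₂)) :
    ∃ (β : FundamentalGroup M y) (γ₁ : FundamentalGroup N₁ x₁) (γ₂ : FundamentalGroup N₂ x₂),
      toPointedClass φ₁ x₁ y (.mk g₁) =
        MulOpposite.op γ₁ • β • toPointedClass φ₁ x₁ y (.mk f₁) ∧
      toPointedClass φ₂ x₂ y (.mk g₂) =
        MulOpposite.op γ₂ • β • toPointedClass φ₂ x₂ y (.mk f₂) := by
  obtain ⟨Q⟩ := h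
  let F₁ : C(I, C^∞⟮𝓡 n₁, N₁; 𝓡 m, M⟯) := ⟨fun t => (Q t).1.1, by fun_prop⟩
  let F₂ : C(I, C^∞⟮𝓡 n₂, N₂; 𝓡 m, M⟯) := ⟨fun t => (Q t).1.2.1, by fun_prop⟩
  have hF₁0 : F₁ 0 = f₁.1 := congrArg (fun q => q.1.1) Q.source
  have hF₁1 : F₁ 1 = g₁.1 := congrArg (fun q => q.1.1) Q.target
  have hF₂0 : F₂ 0 = f₂.1 := congrArg (fun q => q.1.2.1) Q.source
  have hF₂1 : F₂ 1 = g₂.1 := congrArg (fun q => q.1.2.1) Q.target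
  let ρ₁ : Path x₁ x₁ := ⟨⟨fun t => (Q t).1.2.2.1, by fun_prop⟩,
    congrArg (fun q => q.1.2.2.1) Q.source, congrArg (fun q => q.1.2.2.1) Q.target⟩
  let ρ₂ : Path x₂ x₂ := ⟨⟨fun t => (Q t).1.2.2.2, by fun_prop⟩,
    congrArg (fun q => q.1.2.2.2) Q.source, congrArg (fun q => q.1.2.2.2) Q.target⟩
  let c : Path y y := ⟨⟨fun t => F₁ t (ρ₁ t), (continuous_eval_family F₁).comp
    (continuous_id.prodMk ρ₁.continuous)⟩, by simp [hF₁0, f₁.2.2], by simp [hF₁1, g₁.2.2]⟩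
  have h₁ := op_smul_eq_smul_of_track F₁ ρ₁ c (fun _ => rfl)
    (f := ⟨toContinuousMap f₁.1, f₁.2.2⟩) (g := ⟨toContinuousMap g₁.1, g₁.2.2⟩)
    (by rw [hF₁0]) (by rw [hF₁1])
  have h₂ := op_smul_eq_smul_of_track F₂ ρ₂ c (fun t => (Q t).2.2.2.symm)
    (f := ⟨toContinuousMap f₂.1, f₂.2.2⟩) (g := ⟨toContinuousMap g₂.1, g₂.2.2⟩)
    (by rw [hF₂0]) (by rw [hF₂1])
  refine ⟨loopClass c, (loopClass ρ₁)⁻¹, (loopClass ρ₂)⁻¹, ?_, ?_⟩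
  · rw [MulOpposite.op_inv, eq_inv_smul_iff]
    exact h₁
  · rw [MulOpposite.op_inv, eq_inv_smul_iff]
    exact h₂

end Moves

/-- Every point of the coincidence space is joined to a pair of pointed maps. -/
theorem exists_joined_pointedInclusion [ConnectedSpace N₁] [ConnectedSpace N₂]
    [ConnectedSpace M] (x₁ : N₁) (x₂ : N₂) (y : M) (q : CoincidenceSpace φ₁ φ₂) :
    ∃ (f₁ : PointedComponent φ₁ x₁ y) (f₂ : PointedComponent φ₂ x₂ y),
      Joined q (pointedInclusion φ₁ φ₂ x₁ x₂ y f₁ f₂) := by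
  have : LocallyPathConnectedSpace N₁ :=
    ChartedSpace.locallyPathConnectedSpace (EuclideanSpace ℝ (Fin n₁)) N₁
  have : LocallyPathConnectedSpace N₂ :=
    ChartedSpace.locallyPathConnectedSpace (EuclideanSpace ℝ (Fin n₂)) N₂
  have : LocallyPathConnectedSpace M :=
    ChartedSpace.locallyPathConnectedSpace (EuclideanSpace ℝ (Fin m)) M
  have : PathConnectedSpace N₁ := .of_locallyPathConnectedSpace
  have : PathConnectedSpace N₂ := .of_locallyPathConnectedSpace
  have : PathConnectedSpace M := .of_locallyPathConnectedSpace
  obtain ⟨⟨f₁, f₂, ρ₁, ρ₂⟩, hq⟩ := q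
  have he : f₁ ρ₁ = f₂ ρ₂ := hq.2.2
  let p₁ : Path ρ₁ x₁ := PathConnectedSpace.somePath ρ₁ x₁
  let p₂ : Path ρ₂ x₂ := PathConnectedSpace.somePath ρ₂ x₂
  -- move the first point to `x₁`; the second map follows
  obtain ⟨F₂, hF₂0, hF₂⟩ := exists_lift_eval f₂ ρ₂
    ((p₁.map f₁.contMDiff.continuous).cast he.symm rfl)
  obtain ⟨q₁, hq₁, hj₁⟩ := exists_joined_of_paths (φ₁ := φ₁) (φ₂ := φ₂) (.const _ f₁) F₂
    p₁.toContinuousMap (.const _ ρ₂) (fun t => (hF₂ t).symm) (q := ⟨(f₁, f₂, ρ₁, ρ₂), hq⟩)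
    (by simp [hF₂0])
  -- move the second point to `x₂`; the first map follows
  obtain ⟨F₁, hF₁0, hF₁⟩ := exists_lift_eval f₁ x₁
    ((p₂.map (F₂ 1).contMDiff.continuous).cast (by simp [hF₂]) rfl)
  obtain ⟨q₂, hq₂, hj₂⟩ := exists_joined_of_paths (φ₁ := φ₁) (φ₂ := φ₂) F₁ (.const _ (F₂ 1))
    (.const _ x₁) p₂.toContinuousMap (fun t => hF₁ t) (q := q₁) (by simp [hF₁0, hq₁])
  -- move the common value to `y`
  let c : Path (F₁ 1 x₁) y := PathConnectedSpace.somePath _ _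
  have he' : F₂ 1 x₂ = F₁ 1 x₁ := by simp [hF₁]
  obtain ⟨G₁, hG₁0, hG₁⟩ := exists_lift_eval (F₁ 1) x₁ c
  obtain ⟨G₂, hG₂0, hG₂⟩ := exists_lift_eval (F₂ 1) x₂ (c.cast he' rfl)
  obtain ⟨q₃, hq₃, hj₃⟩ := exists_joined_of_paths (φ₁ := φ₁) (φ₂ := φ₂) G₁ G₂
    (.const _ x₁) (.const _ x₂) (fun t => (hG₁ t).trans (hG₂ t).symm) (q := q₂)
    (by simp [hG₁0, hG₂0, hq₂])
  have hq₃₁ : q₃.1.1 = G₁ 1 := congrArg Prod.fst hq₃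
  have hq₃₂ : q₃.1.2.1 = G₂ 1 := congrArg (fun q => q.2.1) hq₃
  let g₁ : PointedComponent φ₁ x₁ y := ⟨G₁ 1, hq₃₁ ▸ q₃.2.1, by simp [hG₁]⟩
  let g₂ : PointedComponent φ₂ x₂ y := ⟨G₂ 1, hq₃₂ ▸ q₃.2.2.1, by simp [hG₂]⟩
  have hg : q₃ = pointedInclusion φ₁ φ₂ x₁ x₂ y g₁ g₂ := Subtype.ext hq₃
  exact ⟨g₁, g₂, hg ▸ (hj₁.trans hj₂).trans hj₃⟩

/-- The map `π₀(𝒩₁•) × π₀(𝒩₂•) → π₀(B)` induced by `pointedInclusion`. -/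
def zerothHomotopyInclusion (φ₁ : C^∞⟮𝓡 n₁, N₁; 𝓡 m, M⟯) (φ₂ : C^∞⟮𝓡 n₂, N₂; 𝓡 m, M⟯)
    (x₁ : N₁) (x₂ : N₂) (y : M) (u : ZerothHomotopy (PointedComponent φ₁ x₁ y) ×
      ZerothHomotopy (PointedComponent φ₂ x₂ y)) : ZerothHomotopy (CoincidenceSpace φ₁ φ₂) :=
  Quotient.map₂ (sa := pathSetoid _) (sb := pathSetoid _) (sc := pathSetoid _)
    (pointedInclusion φ₁ φ₂ x₁ x₂ y)
    (fun _ _ h₁ _ _ h₂ => joined_pointedInclusion h₁ h₂) u.1 u.2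

theorem zerothHomotopyInclusion_eq_iff [CompactSpace N₁] [CompactSpace N₂]
    {u v : ZerothHomotopy (PointedComponent φ₁ x₁ y) ×
      ZerothHomotopy (PointedComponent φ₂ x₂ y)} :
    zerothHomotopyInclusion φ₁ φ₂ x₁ x₂ y u = zerothHomotopyInclusion φ₁ φ₂ x₁ x₂ y v ↔
      doubleQuotientSetoid φ₁ φ₂ x₁ x₂ y u v := by
  have := wellPointed_of_chartedSpace n₁ x₁
  have := wellPointed_of_chartedSpace n₂ x₂
  obtain ⟨u₁, u₂⟩ := u
  obtain ⟨v₁, v₂⟩ := v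
  obtain ⟨f₁, rfl⟩ := ZerothHomotopy.mk_surjective u₁
  obtain ⟨f₂, rfl⟩ := ZerothHomotopy.mk_surjective u₂
  obtain ⟨g₁, rfl⟩ := ZerothHomotopy.mk_surjective v₁
  obtain ⟨g₂, rfl⟩ := ZerothHomotopy.mk_surjective v₂
  constructor
  · intro h
    exact exists_eq_smul_of_joined_pointedInclusion (Quotient.exact (s := pathSetoid _) h)
  · rintro ⟨β, γ₁, γ₂, h₁, h₂⟩
    exact Quotient.sound (s := pathSetoid _)
      (joined_pointedInclusion_of_eq_smul β γ₁ γ₂ h₁ h₂)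

theorem zerothHomotopyInclusion_surjective [ConnectedSpace N₁] [ConnectedSpace N₂]
    [ConnectedSpace M] : Function.Surjective (zerothHomotopyInclusion φ₁ φ₂ x₁ x₂ y) := by
  intro b
  obtain ⟨q, rfl⟩ := ZerothHomotopy.mk_surjective b
  obtain ⟨f₁, f₂, h⟩ := exists_joined_pointedInclusion x₁ x₂ y q
  exact ⟨(.mk f₁, .mk f₂), Quotient.sound (s := pathSetoid _) h.symm⟩

end Coincidence

end CoincidencePi0

end

theorem mainTheorem7 {n₁ n₂ m : ℕ} {N₁ N₂ M : Type*}
    [TopologicalSpace N₁] [ChartedSpace (EuclideanSpace ℝ (Fin n₁)) N₁] [IsManifold (𝓡 n₁) ∞ N₁]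
    [T2Space N₁] [CompactSpace N₁] [ConnectedSpace N₁]
    [TopologicalSpace N₂] [ChartedSpace (EuclideanSpace ℝ (Fin n₂)) N₂] [IsManifold (𝓡 n₂) ∞ N₂]
    [T2Space N₂] [CompactSpace N₂] [ConnectedSpace N₂]
    [TopologicalSpace M] [ChartedSpace (EuclideanSpace ℝ (Fin m)) M] [IsManifold (𝓡 m) ∞ M]
    [T2Space M] [SecondCountableTopology M] [ConnectedSpace M]
    (φ₁ : C^∞⟮𝓡 n₁, N₁; 𝓡 m, M⟯) (φ₂ : C^∞⟮𝓡 n₂, N₂; 𝓡 m, M⟯)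
    (x₁ : N₁) (x₂ : N₂) (y : M) :
    (Function.Injective (CoincidencePi0.toPointedClass φ₁ x₁ y) ∧
      CoincidencePi0.IsInvariant n₁ x₁ y (Set.range (CoincidencePi0.toPointedClass φ₁ x₁ y))) ∧
    (Function.Injective (CoincidencePi0.toPointedClass φ₂ x₂ y) ∧
      CoincidencePi0.IsInvariant n₂ x₂ y (Set.range (CoincidencePi0.toPointedClass φ₂ x₂ y))) ∧
    ∃ e : Quotient (CoincidencePi0.doubleQuotientSetoid φ₁ φ₂ x₁ x₂ y) ≃
        ZerothHomotopy (CoincidencePi0.CoincidenceSpace φ₁ φ₂),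
      ∀ (f₁ : CoincidencePi0.PointedComponent φ₁ x₁ y)
        (f₂ : CoincidencePi0.PointedComponent φ₂ x₂ y),
        e (Quotient.mk _ (ZerothHomotopy.mk f₁, ZerothHomotopy.mk f₂)) =
          ZerothHomotopy.mk (CoincidencePi0.pointedInclusion φ₁ φ₂ x₁ x₂ y f₁ f₂) := by
  open CoincidencePi0 in
  refine ⟨⟨injective_toPointedClass, isInvariant_range_toPointedClass⟩,
    ⟨injective_toPointedClass, isInvariant_range_toPointedClass⟩,
    Equiv.ofBijective (Quotient.lift (zerothHomotopyInclusion φ₁ φ₂ x₁ x₂ y)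
      fun _ _ h => zerothHomotopyInclusion_eq_iff.2 h) ⟨?_, ?_⟩, fun _ _ => rfl⟩
  · rintro ⟨u⟩ ⟨v⟩ h
    exact Quotient.sound (zerothHomotopyInclusion_eq_iff.1 h)
  · intro b
    obtain ⟨u, rfl⟩ := zerothHomotopyInclusion_surjective (x₁ := x₁) (x₂ := x₂) (y := y) b
    exact ⟨Quotient.mk _ u, rfl⟩
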